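/- Let $V$ be a complex vector space of dimension $3$, let $\mathbb P(V)\cong\mathbb P^2_{\mathbb C}$ be the projective plane of one-dimensional quotients of $V$, and let $\mathbb P(V)^\vee=\mathbb P(V^\vee)$ be the dual plane, whose points are the lines of $\mathbb P(V)$. Let $C$ be a smooth connected projective complex curve, i.e. a compact connected Riemann surface (for example the normalization of an irreducible plane curve), and let $$0\to\mathcal L\to V_C\to\mathcal F\to 0$$ be an exact sequence of locally free sheaves on $C$, where $V_C=V\otimes\mathcal O_C$, $\mathcal F$ has rank $2$ and $\mathcal L$ has rank $1$. Let $Z=\mathbb P(\mathcal F)\subset C\times\mathbb P(V)$ be the induced family of lines parameterized by $C$, with projection $\psi:Z\to\mathbb P(V)$, and assume that $\psi$ is a finite morphism. Let the envelope $D\subset\mathbb P(V)$ of $Z$ be the branch locus of $\psi$, i.e. the image under $\psi$ of the set of points of $Z$ at which the differential of $\psi$ is not injective. Let $C'\subset\mathbb P(V)^\vee$ be the image of $C$ under the morphism $C\to\mathbb P(V^\vee)$ given by the quotient $V_C^\vee\cong\bigwedge^2V_C\to\bigwedge^2\mathcal F$. Then the dual curve of $D$, that is, the closure in $\mathbb P(V)^\vee$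 of the set of tangent lines to $D$ at its smooth points (so that a component of $D$ that is a line contributes a point), is equal to $C'$. -/

import Mathlib

open scoped Manifold ContDiff Topology LinearAlgebra.Projectivization

/-- The usual (quotient) topology on the projective space of a complex topological vector space. -/
instance projectivizationTopology {W : Type*} [AddCommGroup W] [Module ℂ W] [TopologicalSpace W] :
    TopologicalSpace (ℙ ℂ W) :=
  inferInstanceAs (TopologicalSpace (Quotient (projectivizationSetoid ℂ W)))

/-! Throughout, `V` is a complex vector space of dimension 3 (a norm only fixes its usual topology
and analytic structure), and `P(V)` is the projective plane of rank-one quotients of `V`, that is, of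
lines in the dual space: `P(V) = ℙ ℂ (StrongDual ℂ V)`.  Accordingly
`P(V)^∨ = P(V^∨) = ℙ ℂ V`, a point `[y]` of which is the line `{[ξ] | ξ y = 0}` of `P(V)`. -/

section DualCurve

variable {V : Type*} [NormedAddCommGroup V] [NormedSpace ℂ V]

/-- `q ∈ P(V)^∨` is the tangent line at `p` of `D ⊆ P(V)`, and `p` is a smooth (one-dimensional)
point of `D`: near a representative `ξ₀` of `p`, the affine cone over `D` is the zero set of a
holomorphic function `G` with `dG(ξ₀) ≠ 0`, and `q` is the line with equation `dG(ξ₀) = 0`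
(so `dG(ξ₀)` is evaluation of functionals at a representative `y` of `q`). -/
def IsTangentLineAt (D : Set (ℙ ℂ (StrongDual ℂ V))) (p : ℙ ℂ (StrongDual ℂ V)) (q : ℙ ℂ V) :
    Prop :=
  p ∈ D ∧ ∃ (ξ₀ : StrongDual ℂ V) (hξ₀ : ξ₀ ≠ 0) (y : V) (hy : y ≠ 0)
    (G : StrongDual ℂ V → ℂ),
    Projectivization.mk ℂ ξ₀ hξ₀ = p ∧ Projectivization.mk ℂ y hy = q ∧
    AnalyticAt ℂ G ξ₀ ∧
    (∀ᶠ ξ in 𝓝 ξ₀, ∀ hξ : ξ ≠ 0, Projectivization.mk ℂ ξ hξ ∈ D ↔ G ξ = 0) ∧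
    ∀ η : StrongDual ℂ V, fderiv ℂ G ξ₀ η = η y

/-- The dual curve of a (reduced, possibly reducible) curve `D ⊆ P(V)`: the closure in `P(V)^∨` of
the set of tangent lines of `D` at its smooth points.  A component of `D` that is a line
contributes one point. -/
def dualCurve (D : Set (ℙ ℂ (StrongDual ℂ V))) : Set (ℙ ℂ V) :=
  closure {q | ∃ p, IsTangentLineAt D p q}

end DualCurve

section Family

variable {V : Type*} [NormedAddCommGroup V] [NormedSpace ℂ V]
  {C : Type*} {F : C → Type*} [∀ c, AddCommGroup (F c)] [∀ c, Module ℂ (F c)]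

/-- The family of lines `Z = P(F) ⊆ C × P(V)` of a quotient `φ : V_C → F`: over `c` it consists of
those rank-one quotients of `V` which factor through `φ c : V → F c`.  The projection
`ψ : Z → P(V)` is `Prod.snd`. -/
def lineFamily (φ : ∀ c, V →ₗ[ℂ] F c) : Set (C × ℙ ℂ (StrongDual ℂ V)) :=
  {z | ∃ η : Module.Dual ℂ (F z.1), ∀ a : V, z.2.rep a = η (φ z.1 a)}

/-- The morphism `ψ : P(F) → P(V)` has finite fibres.  For compact `C` it is proper, so that this
says that `ψ` is a finite morphism. -/
def FiniteProjection (φ : ∀ c, V →ₗ[ℂ] F c) : Prop :=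
  ∀ p : ℙ ℂ (StrongDual ℂ V), {c : C | (c, p) ∈ lineFamily φ}.Finite

/-- The image `C' ⊆ P(V)^∨ = P(V^∨)` of `C` under the map given by the quotients
`V^∨ ≅ ⋀² V → ⋀² (F c)`.  A nonzero alternating 3-form `vol` on `V` gives the isomorphism
`V ≅ (⋀² V)^∨`, `y ↦ vol (y ∧ ·)`, whose transpose is `⋀² V ≅ V^∨`; the point of `P(V^∨) = ℙ ℂ V`
corresponding to the rank-one quotient `⋀² φ_c : ⋀² V → ⋀² (F c)` is the line in `V` of those `y` for
which `vol (y ∧ ·)` factors through `⋀² φ_c`. It does not depend on the choice of `vol`. -/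
def wedgeCurve (φ : ∀ c, V →ₗ[ℂ] F c) : Set (ℙ ℂ V) :=
  {q | ∃ (c : C) (vol : V [⋀^Fin 3]→ₗ[ℂ] ℂ) (η : Module.Dual ℂ (⋀[ℂ]^2 (F c))), vol ≠ 0 ∧
    exteriorPower.alternatingMapLinearEquiv (vol.curryLeft q.rep) =
      η ∘ₗ exteriorPower.map 2 (φ c)}

variable [TopologicalSpace C] [ChartedSpace ℂ C]

/-- The ramification locus of `ψ : Z = P(F) → P(V)`: the points of `Z` at which the differential
of `ψ` has a nonzero kernel.  Tangent vectors to the complex surface `Z` are the velocities of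
holomorphic arcs `s ↦ (γ s, [ξ s])` in `Z`.  The velocity of the arc `[ξ s]` in `P(V)` vanishes at
`s = 0` iff `ξ'(0)` is a multiple of `ξ(0)`, and then the velocity in `Z ⊆ C × P(V)` is nonzero iff
that of `γ` is. -/
def ramificationLocus (φ : ∀ c, V →ₗ[ℂ] F c) : Set (C × ℙ ℂ (StrongDual ℂ V)) :=
  {z | ∃ (γ : ℂ → C) (ξ : ℂ → StrongDual ℂ V),
    ContMDiffAt 𝓘(ℂ) 𝓘(ℂ) ω γ 0 ∧ AnalyticAt ℂ ξ 0 ∧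
    (∀ᶠ s in 𝓝 (0 : ℂ), ∃ h : ξ s ≠ 0, (γ s, Projectivization.mk ℂ (ξ s) h) ∈ lineFamily φ) ∧
    (∃ h : ξ 0 ≠ 0, (γ 0, Projectivization.mk ℂ (ξ 0) h) = z) ∧
    mfderiv 𝓘(ℂ) 𝓘(ℂ) γ 0 ≠ 0 ∧ deriv ξ 0 ∈ Submodule.span ℂ {ξ 0}}

/-- The envelope of the family of lines `P(F)`: the branch locus of `ψ : P(F) → P(V)`, that is, the
image of the ramification locus under `ψ`. -/
def envelope (φ : ∀ c, V →ₗ[ℂ] F c) : Set (ℙ ℂ (StrongDual ℂ V)) :=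
  Prod.snd '' ramificationLocus φ

end Family

/-! Near each point of `C` the kernel of `φ` is spanned by a holomorphic curve `y(s)` in `V ∖ {0}`,
so `C'` is locally `[y(s)]` and the line over `s` is `{ξ(y) = 0}` (`exists_isLocalLift`). Finiteness
of `ψ` says that no germ of `y` lies in a plane; hence neither `y ∧ y'` nor `y ∧ y' ∧ y''` vanishes
identically. Differentiating `ξ(y) = 0` along arcs in `Z` shows that `(s, [ξ])` is ramified iff
`ξ(y) = ξ(y') = 0` (`IsLocalLift.mk_mem_ramificationLocus_iff`). With a volume form `T`, the
envelope is thus made of the dual branches `x(s) = T(y, y')`, together with the whole lines over the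
finitely many points where `y ∧ y' = 0`. The theorem is biduality for these branches.

Tangents lie in `C'` (`IsNondegenerateCurve.tangent_eq_smul`): if `G` vanishes on the envelope, `dG`
at `x(s)` kills `x` and `x' = T(y, y'')`, hence is evaluation at a multiple of `y(s)` when `y ∧ y' ∧
y'' ≠ 0`, and in the limit elsewhere. On a whole line of the envelope the claim is immediate.
Compactness of `C` makes `C'` closed, so the closure stays inside.

Conversely, at a general `s₀` the implicit function theorem gives a local equation of the dual
branch with differential `y` (`exists_dual_equation`). Other branches may pass through the same
point, but by the identity theorem each of them either coincides with this one or avoids its nearby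
points (`IsNondegenerateCurve.eventually_branch`). Compactness of `C` leaves finitely many to
consider, so `[y(s)]` is a tangent line for `s ≠ s₀` near `s₀`, and all of `C'` follows by taking
limits. -/

/-! ### Volume forms on a three-dimensional space. -/

section VolumeForm

variable {V : Type*} [NormedAddCommGroup V] [NormedSpace ℂ V]

/-- A continuous trilinear form on `V` which is alternating and does not vanish on linearly
independent triples. -/
structure IsVolumeForm (T : V →L[ℂ] V →L[ℂ] V →L[ℂ] ℂ) : Prop where
  self_left : ∀ a b, T a a b = 0
  self_outer : ∀ a b, T a b a = 0
  self_right : ∀ a b, T a b b = 0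
  not_linearIndependent : ∀ a b c, T a b c = 0 → ¬ LinearIndependent ℂ ![a, b, c]

theorem exists_isVolumeForm (hV : Module.finrank ℂ V = 3) :
    ∃ T : V →L[ℂ] V →L[ℂ] V →L[ℂ] ℂ, IsVolumeForm T := by
  have : FiniteDimensional ℂ V := Module.finite_of_finrank_pos (by omega)
  let b := Module.finBasisOfFinrankEq ℂ V hV
  let x : Fin 3 → V →L[ℂ] ℂ := fun i => LinearMap.toContinuousLinearMap (b.coord i)
  -- Cofactor expansion of the 3×3 determinant along its last argument.
  let θ : V → V → V →L[ℂ] ℂ := fun u v =>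
    (x 0 u * x 1 v - x 1 u * x 0 v) • x 2 + (x 1 u * x 2 v - x 2 u * x 1 v) • x 0 +
      (x 2 u * x 0 v - x 0 u * x 2 v) • x 1
  let M : V →ₗ[ℂ] V →ₗ[ℂ] V →L[ℂ] ℂ := LinearMap.mk₂ ℂ θ
    (by intros; ext; simp [θ]; ring) (by intros; ext; simp [θ]; ring)
    (by intros; ext; simp [θ]; ring) (by intros; ext; simp [θ]; ring)
  let T : V →L[ℂ] V →L[ℂ] V →L[ℂ] ℂ := LinearMap.toContinuousLinearMap
    ((LinearMap.toContinuousLinearMap (E := V) (F' := V →L[ℂ] ℂ)).toLinearMap ∘ₗ M)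
  have hT : ∀ u v w, T u v w = (x 0 u * x 1 v - x 1 u * x 0 v) * x 2 w +
      (x 1 u * x 2 v - x 2 u * x 1 v) * x 0 w + (x 2 u * x 0 v - x 0 u * x 2 v) * x 1 w := by
    intro u v w
    simp [T, M, θ]
  refine ⟨T, ⟨fun u v => ?_, fun u v => ?_, fun u v => ?_, fun u v w h hl => ?_⟩⟩
  · rw [hT]; ring
  · rw [hT]; ring
  · rw [hT]; ring
  · let b' := basisOfLinearIndependentOfCardEqFinrank hl (by simp [hV])
    have h0 : b.det ≠ 0 := b.det_ne_zero
    rw [← AlternatingMap.map_basis_ne_zero_iff b'] at h0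
    apply h0
    rw [Module.Basis.det_apply, Matrix.det_fin_three]
    simp only [Module.Basis.toMatrix_apply, b', coe_basisOfLinearIndependentOfCardEqFinrank]
    rw [hT] at h
    simp only [x, LinearMap.coe_toContinuousLinearMap', Module.Basis.coord_apply] at h
    simp only [Matrix.cons_val]
    linear_combination h

namespace IsVolumeForm

variable {T : V →L[ℂ] V →L[ℂ] V →L[ℂ] ℂ}

theorem swap_left (hT : IsVolumeForm T) (a b c : V) : T a b c = - T b a c := by
  have h := hT.self_left (a + b) c
  simp only [map_add, add_apply, hT.self_left] at h
  linear_combination h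

theorem swap_right (hT : IsVolumeForm T) (a b c : V) : T a b c = - T a c b := by
  have h := hT.self_right a (b + c)
  simp only [map_add, add_apply, hT.self_right] at h
  linear_combination h

theorem exists_eq_smul_of_eq_zero (hT : IsVolumeForm T) (hV : Module.finrank ℂ V = 3)
    {a b : V} (ha : a ≠ 0) (h : T a b = 0) : ∃ μ : ℂ, b = μ • a := by
  have : FiniteDimensional ℂ V := Module.finite_of_finrank_pos (by omega)
  by_contra! hn
  have hl : LinearIndependent ℂ ![a, b] :=
    (LinearIndependent.pair_iff' ha).2 fun k hk => hn k hk.symm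
  obtain ⟨c, hc⟩ : ∃ c, c ∉ Submodule.span ℂ (Set.range ![a, b]) := by
    by_contra! hall
    have h1 := finrank_span_eq_card hl
    rw [Submodule.eq_top_iff'.2 hall, finrank_top, hV] at h1
    simp at h1
  have h3 := hl.finCons hc
  refine hT.not_linearIndependent c a b ?_ h3
  rw [hT.swap_left, hT.swap_right, h]
  simp

theorem exists_eq_smul_add_smul (hT : IsVolumeForm T)
    {a b c : V} (hab : T a b ≠ 0) (h : T a b c = 0) : ∃ μ ν : ℂ, c = μ • a + ν • b := by
  have ha : a ≠ 0 := by rintro rfl; simp at hab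
  have hl : LinearIndependent ℂ ![a, b] := by
    rw [LinearIndependent.pair_iff' ha]
    rintro k rfl
    apply hab
    ext v
    simp [hT.self_left]
  by_contra! hn
  have hc : c ∉ Submodule.span ℂ (Set.range ![a, b]) := by
    intro hc
    rw [Matrix.range_cons, Matrix.range_cons, Matrix.range_empty, Set.union_empty,
      Set.singleton_union, Submodule.mem_span_pair] at hc
    obtain ⟨μ, ν, hμ⟩ := hc
    exact hn μ ν hμ.symm
  refine hT.not_linearIndependent c a b ?_ (hl.finCons hc)
  rw [hT.swap_left, hT.swap_right, h, neg_zero, neg_zero]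

/-- The kernel of `T a b` is the span of `a` and `b`. Geometrically, `[T a b]` is the intersection
point of the lines `[a]` and `[b]` of the plane `P(V)`. -/
theorem exists_eq_smul_form (hT : IsVolumeForm T) {a b : V} (hab : T a b ≠ 0)
    {ξ : V →L[ℂ] ℂ} (ha : ξ a = 0) (hb : ξ b = 0) : ∃ μ : ℂ, ξ = μ • T a b := by
  have h : (ξ : V →ₗ[ℂ] ℂ) ∈
      Submodule.span ℂ (Set.range fun _ : Unit => (T a b : V →ₗ[ℂ] ℂ)) := by
    apply mem_span_of_iInf_ker_le_ker
    intro v hv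
    simp only [Submodule.mem_iInf, LinearMap.mem_ker, forall_const,
      ContinuousLinearMap.coe_coe] at hv ⊢
    obtain ⟨μ, ν, rfl⟩ := hT.exists_eq_smul_add_smul hab hv
    simp [ha, hb]
  rw [Set.range_const, Submodule.mem_span_singleton] at h
  obtain ⟨μ, hμ⟩ := h
  refine ⟨μ, ?_⟩
  ext v
  exact (LinearMap.congr_fun hμ v).symm

end IsVolumeForm

theorem mem_span_singleton_of_forall_dual {a b : V}
    (h : ∀ ξ : StrongDual ℂ V, ξ a = 0 → ξ b = 0) : ∃ μ : ℂ, b = μ • a := by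
  by_cases ha : a = 0
  · subst ha
    refine ⟨0, ?_⟩
    by_contra hb
    obtain ⟨f, hf⟩ := SeparatingDual.exists_ne_zero (R := ℂ) (x := b) (by simpa using hb)
    exact hf (h f (map_zero f))
  · obtain ⟨f, hf⟩ := SeparatingDual.exists_ne_zero (R := ℂ) ha
    refine ⟨f b / f a, ?_⟩
    by_contra hb
    obtain ⟨g, hg⟩ := SeparatingDual.exists_ne_zero (R := ℂ) (sub_ne_zero.2 hb)
    apply hg
    have := h (g - (g a / f a) • f) (by simp [hf])
    simp only [sub_apply, smul_apply, smul_eq_mul, sub_eq_zero] at this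
    rw [map_sub, this, map_smul, smul_eq_mul]
    field_simp
    ring

end VolumeForm

/-! ### Analytic curves not contained in a plane. -/

section SpanningCurve

open Filter

variable {V : Type*} [NormedAddCommGroup V] [NormedSpace ℂ V]

theorem IsVolumeForm.exists_form_ne_zero {T : V →L[ℂ] V →L[ℂ] V →L[ℂ] ℂ} (hT : IsVolumeForm T)
    (hV : Module.finrank ℂ V = 3) {w : V} (hw : w ≠ 0) : ∃ v, T w v ≠ 0 := by
  by_contra! h
  have h1 : Module.finrank ℂ V = 1 := finrank_eq_one w hw fun v =>
    (hT.exists_eq_smul_of_eq_zero hV hw (h v)).imp fun _ hμ => hμ.symm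
  omega

/-- A curve whose velocity is everywhere proportional to its position has constant direction. -/
theorem eventually_eq_smul_of_deriv_mem_span {W : Type*} [NormedAddCommGroup W] [NormedSpace ℂ W]
    {x : ℂ → W} {s₀ : ℂ} (hx₀ : x s₀ ≠ 0) (hd : ∀ᶠ s in 𝓝 s₀, DifferentiableAt ℂ x s)
    (hs : ∀ᶠ s in 𝓝 s₀, ∃ μ : ℂ, deriv x s = μ • x s) :
    ∀ᶠ s in 𝓝 s₀, ∃ μ : ℂ, x s₀ = μ • x s := by
  obtain ⟨f, hf⟩ := SeparatingDual.exists_ne_zero (R := ℂ) hx₀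
  have hc : ContinuousAt (fun s => f (x s)) s₀ :=
    f.continuous.continuousAt.comp hd.self_of_nhds.continuousAt
  obtain ⟨ε, hε, hball⟩ := Metric.eventually_nhds_iff_ball.1
    (hd.and (hs.and (hc.eventually_ne hf)))
  -- Normalising by `f (z s) = 1` removes the scaling freedom: the velocity, still proportional to
  -- `z`, must vanish.
  let z : ℂ → W := fun s => (f (x s))⁻¹ • x s
  have hz : ∀ s ∈ Metric.ball s₀ ε, HasDerivAt z 0 s := by
    intro s hs
    obtain ⟨h1, ⟨μ, hμ⟩, h3⟩ := hball s hs
    have h4 : HasDerivAt x (μ • x s) s := hμ ▸ h1.hasDerivAt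
    have h5 : HasDerivAt (fun s => f (x s)) (μ * f (x s)) s := by
      have h6 := f.hasFDerivAt.comp_hasDerivAt s h4
      rwa [map_smul, smul_eq_mul] at h6
    have h6 := (h5.inv h3).smul h4
    refine HasDerivAt.congr_deriv (f := z) h6 ?_
    have h7 : (f (x s))⁻¹ * μ + -(μ * f (x s)) / f (x s) ^ 2 = 0 := by
      field_simp
      ring
    rw [smul_smul]
    change ((f (x s))⁻¹ * μ) • x s + _ = 0
    rw [← add_smul, h7, zero_smul]
  filter_upwards [Metric.ball_mem_nhds s₀ hε] with s hs
  have h := Metric.isOpen_ball.is_const_of_deriv_eq_zero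
    (convex_ball s₀ ε).isPreconnected
    (fun s hs => (hz s hs).differentiableAt.differentiableWithinAt)
    (fun s hs => (hz s hs).deriv) (Metric.mem_ball_self hε) hs
  refine ⟨f (x s₀) * (f (x s))⁻¹, ?_⟩
  rw [mul_smul]
  change _ = _ • z s
  rw [← h, smul_smul, mul_inv_cancel₀ hf, one_smul]

/-- An analytic curve in `V ∖ {0}` over an open set, no germ of which lies in a plane. -/
structure IsNondegenerateCurve (y : ℂ → V) (S : Set ℂ) : Prop where
  isOpen : IsOpen S
  analyticAt : ∀ s ∈ S, AnalyticAt ℂ y s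
  ne_zero : ∀ s ∈ S, y s ≠ 0
  not_eventually : ∀ ξ : StrongDual ℂ V, ξ ≠ 0 → ∀ s ∈ S, ¬ ∀ᶠ t in 𝓝 s, ξ (y t) = 0

theorem AnalyticAt.trilinear_apply_apply [CompleteSpace V] {T : V →L[ℂ] V →L[ℂ] V →L[ℂ] ℂ} {a b : ℂ → V} {s : ℂ}
    (ha : AnalyticAt ℂ a s) (hb : AnalyticAt ℂ b s) : AnalyticAt ℂ (fun t => T (a t) (b t)) s :=
  ContDiffAt.analyticAt
    (((T.contDiff.contDiffAt.comp s ha.contDiffAt)).clm_apply hb.contDiffAt)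

theorem AnalyticAt.clm_apply_complex {W W' : Type*} [NormedAddCommGroup W] [NormedSpace ℂ W]
    [NormedAddCommGroup W'] [NormedSpace ℂ W'] [CompleteSpace W'] [CompleteSpace W]
    {a : ℂ → W →L[ℂ] W'} {b : ℂ → W} {s : ℂ}
    (ha : AnalyticAt ℂ a s) (hb : AnalyticAt ℂ b s) : AnalyticAt ℂ (fun t => a t (b t)) s :=
  ContDiffAt.analyticAt (ha.contDiffAt.clm_apply hb.contDiffAt)

theorem HasDerivAt.continuousLinearMap_apply {W : Type*} [NormedAddCommGroup W] [NormedSpace ℂ W] {a : ℂ → V}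
    {s : ℂ} {a' : V} (ha : HasDerivAt a a' s) (L : V →L[ℂ] W) :
    HasDerivAt (fun t => L (a t)) (L a') s :=
  L.hasFDerivAt.comp_hasDerivAt s ha

theorem HasDerivAt.trilinear_apply_apply {T : V →L[ℂ] V →L[ℂ] V →L[ℂ] ℂ} {a b : ℂ → V} {s : ℂ}
    {a' b' : V} (ha : HasDerivAt a a' s) (hb : HasDerivAt b b' s) :
    HasDerivAt (fun t => T (a t) (b t)) (T a' (b s) + T (a s) b') s := by
  have h : HasDerivAt (fun t => T (a t)) (T a') s :=
    ha.continuousLinearMap_apply (W := V →L[ℂ] V →L[ℂ] ℂ) T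
  exact h.clm_apply hb

namespace IsNondegenerateCurve

variable {y : ℂ → V} {S : Set ℂ} {T : V →L[ℂ] V →L[ℂ] V →L[ℂ] ℂ} {s₀ : ℂ}

theorem hasDerivAt (hy : IsNondegenerateCurve y S) {s : ℂ} (hs : s ∈ S) :
    HasDerivAt y (deriv y s) s :=
  (hy.analyticAt s hs).differentiableAt.hasDerivAt

theorem hasDerivAt_deriv [CompleteSpace V] (hy : IsNondegenerateCurve y S) {s : ℂ} (hs : s ∈ S) :
    HasDerivAt (deriv y) (deriv (deriv y) s) s :=
  (hy.analyticAt s hs).deriv.differentiableAt.hasDerivAt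

theorem mem_nhds (hy : IsNondegenerateCurve y S) (hs : s₀ ∈ S) : S ∈ 𝓝 s₀ :=
  hy.isOpen.mem_nhds hs

/-- A plane moving with `y` but with velocity proportional to itself is a fixed plane, and it would
contain a germ of `y`. -/
theorem false_of_constant_direction (hy : IsNondegenerateCurve y S) (hs₀ : s₀ ∈ S)
    {x x' : ℂ → StrongDual ℂ V} (hx₀ : x s₀ ≠ 0) (hd : ∀ᶠ s in 𝓝 s₀, HasDerivAt x (x' s) s)
    (hs : ∀ᶠ s in 𝓝 s₀, ∃ μ : ℂ, x' s = μ • x s) (h0 : ∀ᶠ s in 𝓝 s₀, x s (y s) = 0) : False := by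
  have h := eventually_eq_smul_of_deriv_mem_span hx₀ (hd.mono fun s h => h.differentiableAt)
    ((hd.and hs).mono fun s h => by rw [h.1.deriv]; exact h.2)
  refine hy.not_eventually (x s₀) hx₀ s₀ hs₀ ?_
  filter_upwards [h, h0] with s ⟨μ, hμ⟩ h2
  simp [hμ, h2]

variable (hy : IsNondegenerateCurve y S) (hT : IsVolumeForm T) (hV : Module.finrank ℂ V = 3)
include hy hT hV

/-- Otherwise, by analyticity, `y ∧ y' ∧ w` vanishes near `s₀`. The plane `T(w, y)` through `w` and
`y` then has velocity `T(w, y')` killing both `w` and `y`, so it is constant. Taking `w = y s₀`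
gives `y ∧ y' ≠ 0`. -/
theorem eventually_wedge_ne_zero (hs₀ : s₀ ∈ S) {w : V} (hw : w ≠ 0) :
    ∀ᶠ s in 𝓝[≠] s₀, T (y s) (deriv y s) w ≠ 0 := by
  have : FiniteDimensional ℂ V := Module.finite_of_finrank_pos (by omega)
  have : CompleteSpace V := FiniteDimensional.complete ℂ V
  have han : AnalyticAt ℂ (fun s => T (y s) (deriv y s) w) s₀ :=
    ((hy.analyticAt s₀ hs₀).trilinear_apply_apply (hy.analyticAt s₀ hs₀).deriv).clm_apply_complex
      analyticAt_const
  refine han.eventually_eq_zero_or_eventually_ne_zero.resolve_left fun h => ?_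
  obtain ⟨v, hv⟩ := hT.exists_form_ne_zero hV hw
  -- The plane spanned by `w` and `y` must exist, so the base point moves to a nearby `s₁` where `y`
  -- is not a multiple of `w`.
  have hfr : ∃ᶠ s in 𝓝 s₀, T w v (y s) ≠ 0 :=
    fun h => hy.not_eventually _ hv s₀ hs₀ (h.mono fun _ => not_not.1)
  obtain ⟨s₁, h1, h2, hs₁⟩ := (hfr.and_eventually
    (h.eventually_nhds.and (hy.mem_nhds hs₀))).exists
  have hx₁ : T w (y s₁) ≠ 0 := by
    intro h0
    obtain ⟨μ, hμ⟩ := hT.exists_eq_smul_of_eq_zero hV hw h0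
    apply h1
    rw [hμ, map_smul, hT.self_outer, smul_zero]
  have hd : ∀ᶠ s in 𝓝 s₁, HasDerivAt (fun s => T w (y s)) (T w (deriv y s)) s := by
    filter_upwards [hy.mem_nhds hs₁] with s hs
    simpa using (hasDerivAt_const s w).trilinear_apply_apply (T := T) (hy.hasDerivAt hs)
  refine hy.false_of_constant_direction hs₁ hx₁ hd ?_ (Eventually.of_forall fun s => hT.self_right _ _)
  have hc : ContinuousAt (fun s => T w (y s)) s₁ := hd.self_of_nhds.continuousAt
  filter_upwards [hc.eventually_ne hx₁, h2] with s h3 h4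
  refine hT.exists_eq_smul_form h3 (hT.self_outer _ _) ?_
  rw [hT.swap_left, hT.swap_right, hT.swap_left, h4]
  simp

/-- If the triple product vanishes identically, the velocity `T(y, y'')` of the dual curve `T(y,
y')` kills `y` and `y'`, so the plane of `y` and `y'` is constant. -/
theorem eventually_osculating_ne_zero (hs₀ : s₀ ∈ S) :
    ∀ᶠ s in 𝓝[≠] s₀, T (y s) (deriv y s) (deriv (deriv y) s) ≠ 0 := by
  have : FiniteDimensional ℂ V := Module.finite_of_finrank_pos (by omega)
  have : CompleteSpace V := FiniteDimensional.complete ℂ V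
  have han : AnalyticAt ℂ (fun s => T (y s) (deriv y s) (deriv (deriv y) s)) s₀ :=
    ((hy.analyticAt s₀ hs₀).trilinear_apply_apply (hy.analyticAt s₀ hs₀).deriv).clm_apply_complex
      (hy.analyticAt s₀ hs₀).deriv.deriv
  refine han.eventually_eq_zero_or_eventually_ne_zero.resolve_left fun h => ?_
  obtain ⟨s₁, h1, h2, hs₁⟩ := ((hy.eventually_wedge_ne_zero hT hV hs₀
    (hy.ne_zero s₀ hs₀)).and (((h.eventually_nhds.and (hy.mem_nhds hs₀))).filter_mono
      nhdsWithin_le_nhds)).exists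
  have hx₁ : T (y s₁) (deriv y s₁) ≠ 0 := fun h0 => h1 (by rw [h0]; rfl)
  have hd : ∀ᶠ s in 𝓝 s₁, HasDerivAt (fun s => T (y s) (deriv y s))
      (T (y s) (deriv (deriv y) s)) s := by
    filter_upwards [hy.mem_nhds hs₁] with s hs
    convert (hy.hasDerivAt hs).trilinear_apply_apply (T := T) (hy.hasDerivAt_deriv hs) using 1
    rw [show T (deriv y s) (deriv y s) = 0 from ContinuousLinearMap.ext fun v => hT.self_left _ _,
      zero_add]
  refine hy.false_of_constant_direction hs₁ hx₁ hd ?_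
    (Eventually.of_forall fun s => hT.self_outer _ _)
  have hc : ContinuousAt (fun s => T (y s) (deriv y s)) s₁ := hd.self_of_nhds.continuousAt
  filter_upwards [hc.eventually_ne hx₁, h2] with s h3 h4
  refine hT.exists_eq_smul_form h3 (hT.self_outer _ _) ?_
  rw [hT.swap_right, h4, neg_zero]

end IsNondegenerateCurve

end SpanningCurve

/-! ### Biduality for a single branch. -/

section TangentLines

open Filter

variable {V : Type*} [NormedAddCommGroup V] [NormedSpace ℂ V]

/-- Reflexivity, with `J` continuous so that the vector representing `dG` varies continuously with
the base point. -/
theorem exists_predual [FiniteDimensional ℂ V] :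
    ∃ J : StrongDual ℂ (StrongDual ℂ V) →L[ℂ] V,
      ∀ (D : StrongDual ℂ (StrongDual ℂ V)) (η : StrongDual ℂ V), η (J D) = D η := by
  let b := Module.finBasis ℂ V
  let x : Fin (Module.finrank ℂ V) → StrongDual ℂ V :=
    fun i => LinearMap.toContinuousLinearMap (b.coord i)
  refine ⟨∑ i, (ContinuousLinearMap.apply ℂ ℂ (x i)).smulRight (b i), fun D η => ?_⟩
  have h : η = ∑ i, η (b i) • x i := by
    ext v
    conv_lhs => rw [← b.sum_repr v]
    simp only [map_sum, map_smul, smul_eq_mul, sum_apply, smul_apply, x, mul_comm,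
      LinearMap.coe_toContinuousLinearMap', Module.Basis.coord_apply]
  conv_rhs => rw [h]
  simp [mul_comm]

theorem IsNondegenerateCurve.tangent_eq_smul {y : ℂ → V} {S : Set ℂ}
    {T : V →L[ℂ] V →L[ℂ] V →L[ℂ] ℂ} {s₀ : ℂ} (hy : IsNondegenerateCurve y S)
    (hT : IsVolumeForm T) (hV : Module.finrank ℂ V = 3) (hs₀ : s₀ ∈ S) {ξ₀ : StrongDual ℂ V}
    (hξ₀ : ξ₀ ≠ 0) (h1 : ξ₀ (y s₀) = 0) (h2 : ξ₀ (deriv y s₀) = 0) {G : StrongDual ℂ V → ℂ}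
    (hG : AnalyticAt ℂ G ξ₀)
    (hD : ∀ᶠ ξ in 𝓝 ξ₀, ∀ s ∈ S, ξ (y s) = 0 → ξ (deriv y s) = 0 → G ξ = 0) {v : V}
    (hv : ∀ η, fderiv ℂ G ξ₀ η = η v) : ∃ μ : ℂ, v = μ • y s₀ := by
  have : FiniteDimensional ℂ V := Module.finite_of_finrank_pos (by omega)
  have : CompleteSpace V := FiniteDimensional.complete ℂ V
  by_cases hc : T (y s₀) (deriv y s₀) = 0
  -- Here `y'` is a multiple of `y`, so the whole line `η (y s₀) = 0` belongs to the branch and `dG`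
  -- vanishes along it.
  · obtain ⟨κ, hκ⟩ := hT.exists_eq_smul_of_eq_zero hV (hy.ne_zero _ hs₀) hc
    refine mem_span_singleton_of_forall_dual fun η hη => ?_
    rw [← hv]
    have hd : HasDerivAt (fun t : ℂ => ξ₀ + t • η) η 0 := by
      simpa using ((hasDerivAt_id (0 : ℂ)).smul_const η).const_add ξ₀
    have hz : ξ₀ + (0 : ℂ) • η = ξ₀ := by ext; simp
    have hG' : HasFDerivAt G (fderiv ℂ G ξ₀) (ξ₀ + (0 : ℂ) • η) := by
      rw [hz]
      exact hG.differentiableAt.hasFDerivAt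
    have hcomp := hG'.comp_hasDerivAt (0 : ℂ) hd
    have htd : Tendsto (fun t : ℂ => ξ₀ + t • η) (𝓝 0) (𝓝 ξ₀) := by
      simpa only [hz] using hd.continuousAt.tendsto
    refine hcomp.unique ((hasDerivAt_const (0 : ℂ) (0 : ℂ)).congr_of_eventuallyEq ?_)
    filter_upwards [htd.eventually hD] with t ht
    exact ht s₀ hs₀ (by simp [h1, hη]) (by rw [hκ]; simp [h1, hη])
  · obtain ⟨κ, hκ⟩ := hT.exists_eq_smul_form hc h1 h2
    obtain ⟨J, hJ⟩ := exists_predual (V := V)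
    let x : ℂ → StrongDual ℂ V := fun s => κ • T (y s) (deriv y s)
    have hx₀ : x s₀ = ξ₀ := hκ.symm
    have hκ0 : κ ≠ 0 := by
      rintro rfl
      exact hξ₀ (by ext; simp [hκ])
    have hxd : ∀ s ∈ S, HasDerivAt x (κ • T (y s) (deriv (deriv y) s)) s := by
      intro s hs
      have h := ((hy.hasDerivAt hs).trilinear_apply_apply (T := T)
        (hy.hasDerivAt_deriv hs)).const_smul κ
      rwa [show T (deriv y s) (deriv y s) = 0 from
        ContinuousLinearMap.ext fun v => hT.self_left _ _, zero_add] at h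
    have hxc : Tendsto x (𝓝 s₀) (𝓝 ξ₀) := hx₀ ▸ (hxd s₀ hs₀).continuousAt.tendsto
    let Y : ℂ → V := fun s => J (fderiv ℂ G (x s))
    have hv' : v = Y s₀ := by
      by_contra hne
      obtain ⟨f, hf⟩ := SeparatingDual.exists_ne_zero (R := ℂ) (sub_ne_zero.2 hne)
      apply hf
      rw [map_sub, hJ, hx₀, hv, sub_self]
    have hYc : ContinuousAt Y s₀ := by
      refine J.continuous.continuousAt.comp ?_
      have hf : ContinuousAt (fderiv ℂ G) (x s₀) := by rw [hx₀]; exact hG.fderiv.continuousAt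
      exact hf.comp (hxd s₀ hs₀).continuousAt
    -- Proportionality of `Y` and `y` is proved where `y ∧ y' ∧ y'' ≠ 0`, and reaches `s₀` by
    -- continuity.
    have hzero : ∀ᶠ s in 𝓝[≠] s₀, T (y s) (Y s) = 0 := by
      have hnear := hxc.eventually (hG.eventually_analyticAt.and hD.eventually_nhds)
      filter_upwards [hy.eventually_osculating_ne_zero hT hV hs₀,
        nhdsWithin_le_nhds (hy.mem_nhds hs₀), nhdsWithin_le_nhds hnear] with s h3 hs ⟨h4, h5⟩
      have hGs : HasFDerivAt G (fderiv ℂ G (x s)) (x s) := h4.differentiableAt.hasFDerivAt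
      -- The contact conditions are homogeneous in `ξ`, so `G` vanishes on the multiples of `x s`
      -- near `x s`.
      have hk1 : fderiv ℂ G (x s) (x s) = 0 := by
        have hd : HasDerivAt (fun t : ℂ => t • x s) (x s) 1 := by
          simpa using (hasDerivAt_id (1 : ℂ)).smul_const (x s)
        have htd : Tendsto (fun t : ℂ => t • x s) (𝓝 1) (𝓝 (x s)) := by
          simpa using hd.continuousAt.tendsto
        have hG' : HasFDerivAt G (fderiv ℂ G (x s)) ((1 : ℂ) • x s) := by simpa using hGs
        refine (hG'.comp_hasDerivAt (1 : ℂ) hd).unique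
          ((hasDerivAt_const (1 : ℂ) (0 : ℂ)).congr_of_eventuallyEq ?_)
        filter_upwards [htd.eventually h5] with t ht
        exact ht s hs (by simp [x, hT.self_outer]) (by simp [x, hT.self_right])
      have hk2 : fderiv ℂ G (x s) (κ • T (y s) (deriv (deriv y) s)) = 0 := by
        refine (hGs.comp_hasDerivAt s (hxd s hs)).unique
          ((hasDerivAt_const s (0 : ℂ)).congr_of_eventuallyEq ?_)
        filter_upwards [(hxd s hs).continuousAt.tendsto.eventually h5, hy.mem_nhds hs] with t ht hts
        exact ht t hts (by simp [x, hT.self_outer]) (by simp [x, hT.self_right])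
      rw [← hJ] at hk1 hk2
      have hk1' : T (y s) (deriv y s) (Y s) = 0 := by simpa [x, hκ0] using hk1
      have hk2' : T (y s) (deriv (deriv y) s) (Y s) = 0 := by simpa [x, hκ0] using hk2
      have hne : T (y s) (deriv y s) ≠ 0 := fun h => h3 (by rw [h]; rfl)
      -- `T(y, Y)` kills `y` and `y'`, so it is `ν T(y, y')`; evaluating at `y''` forces `ν = 0`.
      obtain ⟨ν, hν⟩ := hT.exists_eq_smul_form hne (ξ := T (y s) (Y s)) (hT.self_outer _ _)
        (by rw [hT.swap_right, hk1', neg_zero])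
      have h6 := congrArg (fun f => f (deriv (deriv y) s)) hν
      simp only [smul_apply, smul_eq_mul] at h6
      rw [hT.swap_right, hk2', neg_zero, eq_comm, mul_eq_zero, or_iff_left h3] at h6
      rw [hν, h6]
      ext
      simp
    have hcont : ContinuousAt (fun s => T (y s) (Y s)) s₀ := by
      have h1 : ContinuousAt (fun s => T (y s)) s₀ :=
        T.continuous.continuousAt.comp (hy.analyticAt s₀ hs₀).continuousAt
      exact h1.clm_apply hYc
    have h0 : T (y s₀) (Y s₀) = 0 :=
      tendsto_nhds_unique_of_eventuallyEq (hcont.tendsto.mono_left nhdsWithin_le_nhds)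
        tendsto_const_nhds hzero
    rw [hv']
    exact hT.exists_eq_smul_of_eq_zero hV (hy.ne_zero _ hs₀) h0

/-- Near a line `ξ₀` having simple contact with the curve `y`, the dual curve of `y` is smooth, with
equation `ξ (y (σ ξ)) = 0`, where `σ` solves `ξ (y' (σ ξ)) = 0`. -/
theorem exists_dual_equation [CompleteSpace V] {y : ℂ → V} {s₀ : ℂ} {ξ₀ : StrongDual ℂ V}
    (hy : AnalyticAt ℂ y s₀) (h1 : ξ₀ (deriv y s₀) = 0) (h2 : ξ₀ (deriv (deriv y) s₀) ≠ 0)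
    {S : Set ℂ} (hS : S ∈ 𝓝 s₀) :
    ∃ G : StrongDual ℂ V → ℂ, ∃ N ∈ 𝓝 ξ₀, ∃ B ∈ 𝓝 s₀, B ⊆ S ∧
      (∀ ξ ∈ N, G ξ = 0 ↔ ∃ s ∈ B, ξ (y s) = 0 ∧ ξ (deriv y s) = 0) ∧
      (∀ ξ ∈ N, ∀ s ∈ B, ∀ t ∈ B, ξ (deriv y s) = 0 → ξ (deriv y t) = 0 → s = t) ∧
      ∀ ξ ∈ N, ∀ s ∈ B, ξ (deriv y s) = 0 →
        AnalyticAt ℂ G ξ ∧ ∀ η, fderiv ℂ G ξ η = η (y s) := by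
  let f : StrongDual ℂ V × ℂ → ℂ := fun p => p.1 (deriv y p.2)
  have hf : ContDiffAt ℂ ω f (ξ₀, s₀) :=
    contDiffAt_fst.clm_apply (hy.deriv.contDiffAt.comp (ξ₀, s₀) contDiffAt_snd)
  -- The partial derivative of `ξ (y' s)` in `s` is `ξ₀ (y'' s₀)`, nonzero by simple contact.
  have hinv : (fderiv ℂ f (ξ₀, s₀) ∘L ContinuousLinearMap.inr ℂ (StrongDual ℂ V) ℂ).IsInvertible := by
    refine ⟨ContinuousLinearEquiv.unitsEquivAut ℂ (Units.mk0 _ h2), ?_⟩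
    ext
    have hd1 : HasDerivAt (fun s : ℂ => (ξ₀, s)) ((0 : StrongDual ℂ V), (1 : ℂ)) s₀ :=
      (hasDerivAt_const s₀ ξ₀).prodMk (hasDerivAt_id s₀)
    have hd2 : HasDerivAt (fun s : ℂ => ξ₀ (deriv y s)) (ξ₀ (deriv (deriv y) s₀)) s₀ :=
      ξ₀.hasFDerivAt.comp_hasDerivAt s₀ hy.deriv.differentiableAt.hasDerivAt
    have hd3 := (hf.differentiableAt (by simp)).hasFDerivAt.comp_hasDerivAt s₀ hd1
    simpa using hd2.unique hd3
  let σ := hf.implicitFunction (by simp) hinv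
  have hσ : AnalyticAt ℂ σ ξ₀ := (hf.contDiffAt_implicitFunction (by simp) hinv).analyticAt
  have hσ₀ : σ ξ₀ = s₀ := hf.implicitFunction_apply_self (by simp) hinv
  have hev := hf.eventually_apply_eq_iff_implicitFunction (by simp) hinv
  rw [nhds_prod_eq] at hev
  obtain ⟨N₁, hN₁, B₁, hB₁, hNB⟩ := eventually_prod_iff.1 hev
  have hσc : Tendsto σ (𝓝 ξ₀) (𝓝 s₀) := hσ₀ ▸ hσ.continuousAt.tendsto
  have hB : ∀ᶠ s in 𝓝 s₀, B₁ s ∧ AnalyticAt ℂ y s ∧ s ∈ S :=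
    hB₁.and (hy.eventually_analyticAt.and hS)
  have key : ∀ ξ, N₁ ξ → ∀ s, B₁ s → (ξ (deriv y s) = 0 ↔ σ ξ = s) := by
    intro ξ hξ s hs
    have := hNB hξ hs
    simpa only [f, h1] using this
  refine ⟨fun ξ => ξ (y (σ ξ)), _, hN₁.and ((hσc.eventually hB).and hσ.eventually_analyticAt), _, hB,
    fun s hs => hs.2.2, ?_, ?_, ?_⟩
  · rintro ξ ⟨hξ, hσξ, -⟩
    constructor
    · intro h
      exact ⟨σ ξ, hσξ, h, (key ξ hξ _ hσξ.1).2 rfl⟩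
    · rintro ⟨s, hs, h3, h4⟩
      change ξ (y (σ ξ)) = 0
      rwa [(key ξ hξ s hs.1).1 h4]
  · rintro ξ ⟨hξ, -⟩ s hs t ht h3 h4
    rw [← (key ξ hξ s hs.1).1 h3, (key ξ hξ t ht.1).1 h4]
  · rintro ξ ⟨hξ, hσξ, hσa⟩ s hs h3
    have hs' := (key ξ hξ s hs.1).1 h3
    have hya : AnalyticAt ℂ y (σ ξ) := hσξ.2.1
    refine ⟨ContDiffAt.analyticAt
      (contDiffAt_id.clm_apply (hya.contDiffAt.comp ξ hσa.contDiffAt)), fun η => ?_⟩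
    -- The product rule gives `η (y (σ ξ)) + ξ (y' (σ ξ)) dσ(η)`, whose second term vanishes by the
    -- choice of `σ`.
    have hd := (hasFDerivAt_id (𝕜 := ℂ) ξ).clm_apply
      (hya.differentiableAt.hasFDerivAt.comp ξ hσa.differentiableAt.hasFDerivAt)
    have hd' : fderiv ℂ (fun ξ : StrongDual ℂ V => ξ (y (σ ξ))) ξ = _ := hd.fderiv
    rw [hd', hs']
    simp [h3, hs']

end TangentLines

/-! ### The one-dimensional kernel of a surjection from dimension 3 to dimension 2. -/

section Kernel

variable {V W : Type*} [AddCommGroup V] [Module ℂ V] [AddCommGroup W] [Module ℂ W]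

theorem finrank_ker_eq_one (hV : Module.finrank ℂ V = 3) (hW : Module.finrank ℂ W = 2)
    {f : V →ₗ[ℂ] W} (hf : Function.Surjective f) : Module.finrank ℂ f.ker = 1 := by
  have : FiniteDimensional ℂ V := Module.finite_of_finrank_pos (by omega)
  have h := f.finrank_range_add_finrank_ker
  rw [LinearMap.range_eq_top.2 hf, finrank_top] at h
  omega

theorem exists_ne_zero_apply_eq_zero (hV : Module.finrank ℂ V = 3) (hW : Module.finrank ℂ W = 2)
    {f : V →ₗ[ℂ] W} (hf : Function.Surjective f) : ∃ a, a ≠ 0 ∧ f a = 0 := by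
  obtain ⟨v, hv, -⟩ := finrank_eq_one_iff'.1 (finrank_ker_eq_one hV hW hf)
  exact ⟨v, by simpa using hv, v.2⟩

theorem exists_eq_smul_of_apply_eq_zero (hV : Module.finrank ℂ V = 3)
    (hW : Module.finrank ℂ W = 2) {f : V →ₗ[ℂ] W} (hf : Function.Surjective f) {a b : V}
    (ha0 : a ≠ 0) (ha : f a = 0) (hb : f b = 0) : ∃ μ : ℂ, b = μ • a := by
  obtain ⟨μ, hμ⟩ := exists_smul_eq_of_finrank_eq_one (finrank_ker_eq_one hV hW hf)
    (x := (⟨a, ha⟩ : f.ker)) (fun h => ha0 (congrArg Subtype.val h)) ⟨b, hb⟩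
  exact ⟨μ, by simpa using (congrArg Subtype.val hμ).symm⟩

end Kernel

/-! ### The family of lines and `C'` in terms of the kernels of `φ`. -/

section Incidence

variable {V : Type*} [NormedAddCommGroup V] [NormedSpace ℂ V]
  {C : Type*} {F : C → Type*} [∀ c, AddCommGroup (F c)] [∀ c, Module ℂ (F c)]
  {φ : ∀ c, V →ₗ[ℂ] F c}

theorem mk_mem_lineFamily_iff {c : C} (hφ : Function.Surjective (φ c)) {ξ : StrongDual ℂ V}
    (hξ : ξ ≠ 0) :
    (c, Projectivization.mk ℂ ξ hξ) ∈ lineFamily φ ↔ ∀ a, φ c a = 0 → ξ a = 0 := by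
  obtain ⟨u, hu⟩ := Projectivization.exists_smul_eq_mk_rep ℂ ξ hξ
  have hu' : ∀ a, (Projectivization.mk ℂ ξ hξ).rep a = u * ξ a := fun a => by
    rw [← hu]; rfl
  constructor
  · rintro ⟨η, hη⟩ a ha
    have h := hη a
    simpa [hu', ha] using h
  · intro h
    obtain ⟨g, hg⟩ := (φ c).exists_rightInverse_of_surjective (LinearMap.range_eq_top.2 hφ)
    refine ⟨(u : ℂ) • (ξ : V →ₗ[ℂ] ℂ) ∘ₗ g, fun a => ?_⟩
    have h1 : φ c (g (φ c a) - a) = 0 := by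
      rw [map_sub, sub_eq_zero]
      exact LinearMap.congr_fun hg _
    have h2 := h _ h1
    rw [map_sub, sub_eq_zero] at h2
    simp [hu', h2]

/-- If `vol (q ∧ ·)` factors through `⋀² φ_c`, it kills `k ∧ b` for `k` in the kernel and every `b`,
which forces `k` to be proportional to `q`. Conversely, a section `g` of `φ c` satisfies `g (φ c a)
= a` modulo `q`, so it provides the factorisation. -/
theorem mem_wedgeCurve_iff (hV : Module.finrank ℂ V = 3) (hF : ∀ c, Module.finrank ℂ (F c) = 2)
    (hφ : ∀ c, Function.Surjective (φ c)) {q : ℙ ℂ V} :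
    q ∈ wedgeCurve φ ↔ ∃ c, φ c q.rep = 0 := by
  have : FiniteDimensional ℂ V := Module.finite_of_finrank_pos (by omega)
  constructor
  · rintro ⟨c, vol, η, hvol, h⟩
    refine ⟨c, ?_⟩
    obtain ⟨k, hk0, hk⟩ := exists_ne_zero_apply_eq_zero hV (hF c) (hφ c)
    have hkb : ∀ b, vol ![q.rep, k, b] = 0 := by
      intro b
      have h1 := LinearMap.congr_fun h (exteriorPower.ιMulti ℂ 2 ![k, b])
      rw [exteriorPower.alternatingMapLinearEquiv_apply_ιMulti, LinearMap.comp_apply,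
        exteriorPower.map_apply_ιMulti] at h1
      rw [(exteriorPower.ιMulti ℂ 2).map_coord_zero (m := φ c ∘ ![k, b]) 0 (by simp [hk]),
        map_zero] at h1
      exact h1
    obtain ⟨μ, hμ⟩ : ∃ μ : ℂ, k = μ • q.rep := by
      by_contra! hn
      have hl : LinearIndependent ℂ ![q.rep, k] :=
        (LinearIndependent.pair_iff' q.rep_nonzero).2 fun a ha => hn a ha.symm
      obtain ⟨b, hb⟩ : ∃ b, b ∉ Submodule.span ℂ (Set.range ![q.rep, k]) := by
        by_contra! hall
        have h1 := finrank_span_eq_card hl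
        rw [Submodule.eq_top_iff'.2 hall, finrank_top, hV] at h1
        simp at h1
      have hl3 := hl.finCons hb
      let b' := basisOfLinearIndependentOfCardEqFinrank hl3 (by simp [hV])
      apply (AlternatingMap.map_basis_ne_zero_iff b' vol).2 hvol
      -- The basis built above has `b` in front, hence the rotation.
      have hrot := vol.map_perm ![q.rep, k, b] (finRotate 3).symm
      rw [hkb, smul_zero] at hrot
      rw [← hrot]
      congr 1
      ext i
      fin_cases i <;> simp [b']
    have hμ0 : μ ≠ 0 := by
      rintro rfl
      exact hk0 (by rw [hμ, zero_smul])
    rw [hμ, map_smul] at hk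
    exact (smul_eq_zero.1 hk).resolve_left hμ0
  · rintro ⟨c, hc⟩
    let vol := (Module.finBasisOfFinrankEq ℂ V hV).det
    obtain ⟨g, hg⟩ := (φ c).exists_rightInverse_of_surjective (LinearMap.range_eq_top.2 (hφ c))
    refine ⟨c, vol, exteriorPower.alternatingMapLinearEquiv
      ((vol.curryLeft q.rep).compLinearMap g), Module.Basis.det_ne_zero _, ?_⟩
    apply exteriorPower.linearMap_ext
    ext m
    simp only [LinearMap.compAlternatingMap_apply, LinearMap.comp_apply,
      exteriorPower.map_apply_ιMulti, exteriorPower.alternatingMapLinearEquiv_apply_ιMulti]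
    have hm : ∀ a, ∃ μ : ℂ, g (φ c a) = a + μ • q.rep := by
      intro a
      obtain ⟨μ, hμ⟩ := exists_eq_smul_of_apply_eq_zero hV (hF c) (hφ c) q.rep_nonzero hc
        (b := g (φ c a) - a) (by rw [map_sub, sub_eq_zero]; exact LinearMap.congr_fun hg _)
      exact ⟨μ, by rw [← hμ]; abel⟩
    obtain ⟨μ, hμ⟩ := hm (m 0)
    obtain ⟨ν, hν⟩ := hm (m 1)
    have h1 : ((vol.curryLeft q.rep).compLinearMap g) (φ c ∘ m) =
        vol ![q.rep, m 0 + μ • q.rep, m 1 + ν • q.rep] := by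
      rw [← hμ, ← hν]
      simp only [AlternatingMap.compLinearMap_apply, AlternatingMap.curryLeft_apply_apply]
      congr 1
      ext i
      fin_cases i <;> rfl
    rw [h1]
    have h2 : (vol.curryLeft q.rep) m = vol ![q.rep, m 0, m 1] := by
      rw [AlternatingMap.curryLeft_apply_apply]
      congr 1
      ext i
      fin_cases i <;> rfl
    rw [h2]
    simp only [vol, Module.Basis.det_apply, Matrix.det_fin_three, Module.Basis.toMatrix_apply]
    simp
    ring

theorem mk_mem_wedgeCurve_iff (hV : Module.finrank ℂ V = 3)
    (hF : ∀ c, Module.finrank ℂ (F c) = 2) (hφ : ∀ c, Function.Surjective (φ c))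
    {v : V} (hv : v ≠ 0) : Projectivization.mk ℂ v hv ∈ wedgeCurve φ ↔ ∃ c, φ c v = 0 := by
  rw [mem_wedgeCurve_iff hV hF hφ]
  obtain ⟨u, hu⟩ := Projectivization.exists_smul_eq_mk_rep ℂ v hv
  rw [← hu]
  simp [Units.smul_def]

end Incidence

/-! ### Local holomorphic generators of the kernel line bundle. -/

section LocalLift

open Filter

variable {V : Type*} [NormedAddCommGroup V] [NormedSpace ℂ V]
  {C : Type*} [TopologicalSpace C] [ChartedSpace ℂ C]
  {F : C → Type*} [∀ c, AddCommGroup (F c)] [∀ c, Module ℂ (F c)]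

/-- In the chart at `c₀`, the kernel of `φ` is spanned over `S` by the nondegenerate curve `y`. -/
structure IsLocalLift (φ : ∀ c, V →ₗ[ℂ] F c) (c₀ : C) (y : ℂ → V) (S : Set ℂ) : Prop where
  curve : IsNondegenerateCurve y S
  mem : chartAt ℂ c₀ c₀ ∈ S
  subset_target : S ⊆ (chartAt ℂ c₀).target
  apply_eq_zero_iff : ∀ s ∈ S, ∀ a, φ ((chartAt ℂ c₀).symm s) a = 0 ↔ ∃ μ : ℂ, a = μ • y s

theorem analyticAt_clm_of_apply {E : Type*} [NormedAddCommGroup E] [NormedSpace ℂ E]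
    [FiniteDimensional ℂ V] {A : ℂ → V →L[ℂ] E} {s₀ : ℂ}
    (h : ∀ a, AnalyticAt ℂ (fun s => A s a) s₀) : AnalyticAt ℂ A s₀ := by
  let b := Module.finBasis ℂ V
  let x : Fin (Module.finrank ℂ V) → StrongDual ℂ V :=
    fun i => LinearMap.toContinuousLinearMap (b.coord i)
  have hA : A = fun s => ∑ i, ContinuousLinearMap.smulRightL ℂ V E (x i) (A s (b i)) := by
    funext s
    ext v
    conv_lhs => rw [← b.sum_repr v]
    simp [x, -Module.Basis.sum_repr]
  rw [hA]
  refine Finset.analyticAt_fun_sum _ fun i _ => ?_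
  exact (ContinuousLinearMap.analyticAt _ _).comp (h (b i))

/-- Near a point where it is onto, an analytic family of linear maps has an analytic family of
kernel vectors through any given one. -/
theorem exists_analyticAt_kernel {E : Type*} [NormedAddCommGroup E] [NormedSpace ℂ E]
    [FiniteDimensional ℂ V] [FiniteDimensional ℂ E] {A : ℂ → V →L[ℂ] E} {s₀ : ℂ}
    (hA : AnalyticAt ℂ A s₀) (hs : Function.Surjective (A s₀)) {k : V} (hk : A s₀ k = 0) :
    ∃ y : ℂ → V, AnalyticAt ℂ y s₀ ∧ y s₀ = k ∧
      ∀ᶠ s in 𝓝 s₀, A s (y s) = 0 ∧ Function.Surjective (A s) := by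
  have : CompleteSpace V := FiniteDimensional.complete ℂ V
  have : CompleteSpace E := FiniteDimensional.complete ℂ E
  obtain ⟨g, hg⟩ := (A s₀ : V →ₗ[ℂ] E).exists_rightInverse_of_surjective
    (LinearMap.range_eq_top.2 hs)
  let B : E →L[ℂ] V := LinearMap.toContinuousLinearMap g
  let M : ℂ → E →L[ℂ] E := fun s => (A s).comp B
  have hM₀ : M s₀ = 1 := by
    ext v
    exact LinearMap.congr_fun hg v
  have hM : AnalyticAt ℂ M s₀ :=
    ContDiffAt.analyticAt (hA.contDiffAt.clm_comp contDiffAt_const)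
  have hinv : AnalyticAt ℂ (fun s => Ring.inverse (M s)) s₀ := by
    have h1 : AnalyticAt ℂ Ring.inverse (M s₀) := by
      rw [hM₀]
      exact analyticAt_inverse (𝕜 := ℂ) (1 : (E →L[ℂ] E)ˣ)
    exact h1.comp hM
  have hAk : AnalyticAt ℂ (fun s => A s k) s₀ := hA.clm_apply_complex analyticAt_const
  -- `B (A s B)⁻¹` is a right inverse of `A s`, available near `s₀` because `A s₀ B = 1`; it
  -- corrects the constant vector `k` into the kernel.
  refine ⟨fun s => k - B (Ring.inverse (M s) (A s k)), ?_, ?_, ?_⟩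
  · exact analyticAt_const.sub ((B.analyticAt _).comp (hinv.clm_apply_complex hAk))
  · simp [hk]
  · have hu : ∀ᶠ s in 𝓝 s₀, IsUnit (M s) :=
      hM.continuousAt.eventually (Units.isOpen.mem_nhds (by rw [hM₀]; exact isUnit_one))
    filter_upwards [hu] with s hs
    have h1 : ∀ v, A s (B (Ring.inverse (M s) v)) = v := fun v =>
      congrArg (fun f : E →L[ℂ] E => f v) (Ring.mul_inverse_cancel _ hs)
    exact ⟨by rw [map_sub, h1, sub_self], fun v => ⟨_, h1 v⟩⟩

theorem exists_isLocalLift (hV : Module.finrank ℂ V = 3) [IsManifold 𝓘(ℂ) ω C]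
    {E : Type*} [NormedAddCommGroup E] [NormedSpace ℂ E] (hE : Module.finrank ℂ E = 2)
    [TopologicalSpace (Bundle.TotalSpace E F)] [∀ c, TopologicalSpace (F c)] [FiberBundle E F]
    [VectorBundle ℂ E F] {φ : ∀ c, V →ₗ[ℂ] F c}
    (hφ_hol : ∀ a : V, ContMDiff 𝓘(ℂ) (𝓘(ℂ).prod 𝓘(ℂ, E)) ω
      (fun c => (Bundle.TotalSpace.mk' E c (φ c a) : Bundle.TotalSpace E F)))
    (hφ : ∀ c, Function.Surjective (φ c)) (hψ : FiniteProjection φ) (c₀ : C) :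
    ∃ y S, IsLocalLift φ c₀ y S := by
  have : FiniteDimensional ℂ V := Module.finite_of_finrank_pos (by omega)
  have : FiniteDimensional ℂ E := Module.finite_of_finrank_pos (by omega)
  let e := trivializationAt E F c₀
  let χ := chartAt ℂ c₀
  let s₀ := χ c₀
  have hc₀ : c₀ ∈ χ.source := mem_chart_source ℂ c₀
  have hs₀ : s₀ ∈ χ.target := χ.map_source hc₀
  have hχs₀ : χ.symm s₀ = c₀ := χ.left_inv hc₀
  let A : ℂ → V →L[ℂ] E := fun s =>
    LinearMap.toContinuousLinearMap (e.linearMapAt ℂ (χ.symm s) ∘ₗ φ (χ.symm s))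
  have hsymm : ContMDiffAt 𝓘(ℂ) 𝓘(ℂ) ω χ.symm s₀ :=
    (contMDiffOn_chart_symm (I := 𝓘(ℂ)) (n := ω) (x := c₀)).contMDiffAt (χ.open_target.mem_nhds hs₀)
  have hbase : ∀ᶠ s in 𝓝 s₀, χ.symm s ∈ e.baseSet := by
    refine hsymm.continuousAt.eventually (e.open_baseSet.mem_nhds ?_)
    rw [hχs₀]
    exact FiberBundle.mem_baseSet_trivializationAt' c₀
  have hAe : ∀ s, χ.symm s ∈ e.baseSet → ∀ a, A s a = (e ⟨χ.symm s, φ (χ.symm s) a⟩).2 := by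
    intro s hs a
    change e.linearMapAt ℂ (χ.symm s) (φ (χ.symm s) a) = _
    rw [e.linearMapAt_apply, if_pos hs]
  have hA : AnalyticAt ℂ A s₀ := by
    refine analyticAt_clm_of_apply fun a => ?_
    have h1 := (Bundle.contMDiffAt_section c₀).1 (hφ_hol a c₀)
    rw [← hχs₀] at h1
    have h2 := (h1.comp s₀ hsymm).contDiffAt.analyticAt
    refine h2.congr ?_
    filter_upwards [hbase] with s hs
    rw [hAe s hs, hχs₀]
    rfl
  have hker : ∀ s, χ.symm s ∈ e.baseSet → ∀ a, A s a = 0 ↔ φ (χ.symm s) a = 0 := by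
    intro s hs a
    change e.linearMapAt ℂ (χ.symm s) (φ (χ.symm s) a) = 0 ↔ _
    rw [e.linearMapAt_apply, if_pos hs]
    change (e.linearEquivAt ℂ (χ.symm s) hs) (φ (χ.symm s) a) = 0 ↔ _
    exact LinearEquiv.map_eq_zero_iff _
  have hsurj₀ : Function.Surjective (A s₀) := by
    have hs := hbase.self_of_nhds
    have : (A s₀ : V → E) = e.linearEquivAt ℂ (χ.symm s₀) hs ∘ φ (χ.symm s₀) := by
      funext a
      rw [hAe s₀ hs]
      rfl
    rw [this]
    exact (LinearEquiv.surjective _).comp (hφ _)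
  obtain ⟨k, hk0, hk⟩ := exists_ne_zero_apply_eq_zero hV hE (f := (A s₀ : V →ₗ[ℂ] E)) hsurj₀
  obtain ⟨y, hya, hy₀, hyA⟩ := exists_analyticAt_kernel hA hsurj₀ hk
  have hyne : ∀ᶠ s in 𝓝 s₀, y s ≠ 0 := hya.continuousAt.eventually_ne (hy₀ ▸ hk0)
  obtain ⟨S, hS, hSo, hS₀⟩ := mem_nhds_iff.1 ((hya.eventually_analyticAt.and hyne).and
    ((hyA.and hbase).and (χ.open_target.mem_nhds hs₀)))
  have hlift : ∀ s ∈ S, ∀ a, φ (χ.symm s) a = 0 ↔ ∃ μ : ℂ, a = μ • y s := by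
    intro s hs a
    obtain ⟨⟨-, h2⟩, ⟨⟨h3, h4⟩, h5⟩, h6⟩ := hS hs
    rw [← hker s h5]
    constructor
    · intro ha
      exact exists_eq_smul_of_apply_eq_zero hV hE (f := (A s : V →ₗ[ℂ] E)) h4 h2 h3 ha
    · rintro ⟨μ, rfl⟩
      rw [map_smul, h3, smul_zero]
  refine ⟨y, S, ⟨hSo, fun s hs => (hS hs).1.1, fun s hs => (hS hs).1.2, ?_⟩, hS₀,
    fun s hs => (hS hs).2.2, hlift⟩
  -- Finiteness of `ψ` enters here: a germ of `y` in the plane `ξ = 0` would put infinitely many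
  -- lines of the family through the point `[ξ]`.
  intro ξ hξ s hs h
  have hmem : {t | ξ (y t) = 0} ∩ S ∈ 𝓝 s := inter_mem h (hSo.mem_nhds hs)
  refine (infinite_of_mem_nhds s hmem) (Set.Finite.of_finite_image
    ((hψ (Projectivization.mk ℂ ξ hξ)).subset ?_)
    (χ.symm.injOn.mono fun t ht => (hS ht.2).2.2))
  rintro _ ⟨t, ⟨ht, htS⟩, rfl⟩
  rw [Set.mem_ofPred_eq, mk_mem_lineFamily_iff (hφ _)]
  intro a ha
  obtain ⟨μ, rfl⟩ := (hlift t htS a).1 ha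
  rw [map_smul, ht, smul_zero]

end LocalLift

/-! ### The ramification locus in local coordinates. -/

section Ramification

open Filter

variable {V : Type*} [NormedAddCommGroup V] [NormedSpace ℂ V]
  {C : Type*} [TopologicalSpace C] [ChartedSpace ℂ C]
  {F : C → Type*} [∀ c, AddCommGroup (F c)] [∀ c, Module ℂ (F c)]
  {φ : ∀ c, V →ₗ[ℂ] F c} {c₀ : C} {y : ℂ → V} {S : Set ℂ}

theorem IsLocalLift.mk_mem_lineFamily_iff (h : IsLocalLift φ c₀ y S)
    (hφ : ∀ c, Function.Surjective (φ c)) {s : ℂ} (hs : s ∈ S) {ξ : StrongDual ℂ V} (hξ : ξ ≠ 0) :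
    ((chartAt ℂ c₀).symm s, Projectivization.mk ℂ ξ hξ) ∈ lineFamily φ ↔ ξ (y s) = 0 := by
  rw [_root_.mk_mem_lineFamily_iff (hφ _)]
  constructor
  · exact fun h' => h' _ ((h.apply_eq_zero_iff s hs _).2 ⟨1, (one_smul _ _).symm⟩)
  · intro h' a ha
    obtain ⟨μ, rfl⟩ := (h.apply_eq_zero_iff s hs a).1 ha
    rw [map_smul, h', smul_zero]

/-- Differentiating `ξ(t)(y(u(t))) = 0` at `0` gives `ξ'(y) + u' ξ(y') = 0`. The first term vanishes
because `ξ'` is a multiple of `ξ`, and `u' ≠ 0`. The converse needs an explicit arc. -/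
theorem IsLocalLift.mk_mem_ramificationLocus_iff [IsManifold 𝓘(ℂ) ω C]
    (h : IsLocalLift φ c₀ y S) (hφ : ∀ c, Function.Surjective (φ c)) {s₁ : ℂ} (hs₁ : s₁ ∈ S)
    {ξ₁ : StrongDual ℂ V} (hξ₁ : ξ₁ ≠ 0) :
    ((chartAt ℂ c₀).symm s₁, Projectivization.mk ℂ ξ₁ hξ₁) ∈ ramificationLocus φ ↔
      ξ₁ (y s₁) = 0 ∧ ξ₁ (deriv y s₁) = 0 := by
  let χ := chartAt ℂ c₀
  have hs₁t : s₁ ∈ χ.target := h.subset_target hs₁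
  have hsymm : ContMDiffAt 𝓘(ℂ) 𝓘(ℂ) ω χ.symm s₁ :=
    (contMDiffOn_chart_symm (I := 𝓘(ℂ)) (n := ω) (x := c₀)).contMDiffAt
      (χ.open_target.mem_nhds hs₁t)
  have hχ : ContMDiffAt 𝓘(ℂ) 𝓘(ℂ) ω χ (χ.symm s₁) :=
    (contMDiffOn_chart (I := 𝓘(ℂ)) (n := ω) (x := c₀)).contMDiffAt
      (χ.open_source.mem_nhds (χ.map_target hs₁t))
  have hχs₁ : χ (χ.symm s₁) = s₁ := χ.right_inv hs₁t
  have hyd := h.curve.hasDerivAt hs₁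
  constructor
  · rintro ⟨γ, ξ, hγ, hξ, hev, ⟨hξ0, heq⟩, hm, hspan⟩
    obtain ⟨hγ0, hmk⟩ := Prod.mk.inj heq
    change γ 0 = χ.symm s₁ at hγ0
    obtain ⟨a, ha⟩ := (Projectivization.mk_eq_mk_iff' ℂ _ _ hξ0 hξ₁).1 hmk
    have ha0 : a ≠ 0 := by
      rintro rfl
      exact hξ0 (by rw [← ha]; ext; simp)
    let u : ℂ → ℂ := fun t => χ (γ t)
    have hu0 : u 0 = s₁ := by simp [u, hγ0, hχs₁]
    have huM : ContMDiffAt 𝓘(ℂ) 𝓘(ℂ) ω u 0 := by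
      rw [← hγ0] at hχ
      exact hχ.comp 0 hγ
    have hud : HasDerivAt u (deriv u 0) 0 :=
      (huM.contDiffAt.differentiableAt (by simp)).hasDerivAt
    have hγu : γ =ᶠ[𝓝 0] χ.symm ∘ u := by
      have : ∀ᶠ t in 𝓝 (0 : ℂ), γ t ∈ χ.source :=
        hγ.continuousAt.eventually (χ.open_source.mem_nhds (by
          rw [hγ0]; exact χ.map_target hs₁t))
      filter_upwards [this] with t ht
      exact (χ.left_inv ht).symm
    have hu' : deriv u 0 ≠ 0 := by
      intro h0
      apply hm
      rw [hγu.mfderiv_eq, mfderiv_comp (I' := 𝓘(ℂ)) (0 : ℂ)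
        (by rw [hu0]; exact hsymm.mdifferentiableAt (by simp)) (huM.mdifferentiableAt (by simp))]
      have h1 : mfderiv 𝓘(ℂ) 𝓘(ℂ) u 0 = 0 := by
        rw [mfderiv_eq_fderiv]
        have := hud.hasFDerivAt.fderiv
        rw [this, h0]
        exact ContinuousLinearMap.toSpanSingleton_zero ℂ
      rw [h1]
      exact ContinuousLinearMap.comp_zero _
    have hinc : ∀ᶠ t in 𝓝 (0 : ℂ), ξ t (y (u t)) = 0 := by
      have hS : ∀ᶠ t in 𝓝 (0 : ℂ), u t ∈ S :=
        huM.continuousAt.eventually (h.curve.mem_nhds (by rw [hu0]; exact hs₁))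
      filter_upwards [hγu, hS, hev] with t h1 h2 ⟨h3, h4⟩
      rw [h1] at h4
      exact (h.mk_mem_lineFamily_iff hφ h2 h3).1 h4
    have hy0 : ξ 0 (y s₁) = 0 := by rw [← hu0]; exact hinc.self_of_nhds
    have hd1 : HasDerivAt (fun t => y (u t)) (deriv u 0 • deriv y s₁) 0 := by
      rw [← hu0] at hyd
      have := hyd.scomp (0 : ℂ) hud
      rwa [hu0] at this
    have hd := hξ.differentiableAt.hasDerivAt.clm_apply hd1
    have hd0 := hd.unique ((hasDerivAt_const (0 : ℂ) (0 : ℂ)).congr_of_eventuallyEq hinc)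
    obtain ⟨b, hb⟩ := Submodule.mem_span_singleton.1 hspan
    rw [← hb, hu0] at hd0
    simp only [smul_apply, hy0, mul_zero, zero_add, map_smul, smul_eq_mul, mul_eq_zero, hu',
      false_or] at hd0
    rw [← ha] at hy0 hd0
    simp only [smul_apply, smul_eq_mul, mul_eq_zero, ha0, false_or] at hy0 hd0
    exact ⟨hy0, hd0⟩
  · rintro ⟨h1, h2⟩
    obtain ⟨f, hf⟩ := SeparatingDual.exists_ne_zero (R := ℂ) (h.curve.ne_zero s₁ hs₁)
    let τ : ℂ → ℂ := fun t => s₁ + t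
    have hτ0 : τ 0 = s₁ := add_zero s₁
    have hτa : AnalyticAt ℂ τ 0 := analyticAt_const.add analyticAt_id
    have hτd : HasDerivAt τ 1 0 := (hasDerivAt_id (0 : ℂ)).const_add s₁
    have hτM : ContMDiffAt 𝓘(ℂ) 𝓘(ℂ) ω τ 0 := hτa.contDiffAt.contMDiffAt
    have hya : AnalyticAt ℂ (fun t => y (τ t)) 0 :=
      AnalyticAt.comp (by rw [hτ0]; exact h.curve.analyticAt s₁ hs₁) hτa
    have hfy0 : f (y (τ 0)) ≠ 0 := by rw [hτ0]; exact hf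
    -- Subtracting `g • f` from `ξ₁` makes it kill `y (τ t)`. Contact makes `g` vanish to second
    -- order, so the arc has zero velocity in `P(V)`.
    let g : ℂ → ℂ := fun t => ξ₁ (y (τ t)) / f (y (τ t))
    have hga : AnalyticAt ℂ g 0 :=
      ((ξ₁.analyticAt _).comp hya).div ((f.analyticAt _).comp hya) hfy0
    have hg0 : g 0 = 0 := by simp [g, hτ0, h1]
    have hgd : HasDerivAt g 0 0 := by
      have hd1 : HasDerivAt (fun t => y (τ t)) (deriv y s₁) 0 := by
        rw [← hτ0] at hyd
        have := hyd.scomp (0 : ℂ) hτd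
        rwa [hτ0, one_smul] at this
      have hd2 : HasDerivAt (fun t => ξ₁ (y (τ t))) (ξ₁ (deriv y s₁)) 0 :=
        hd1.continuousLinearMap_apply ξ₁
      have hd3 : HasDerivAt (fun t => f (y (τ t))) (f (deriv y s₁)) 0 :=
        hd1.continuousLinearMap_apply f
      refine (hd2.div hd3 hfy0).congr_deriv ?_
      simp [h2, hτ0, h1]
    let ξ : ℂ → StrongDual ℂ V := fun t => ξ₁ - g t • f
    have hξ0 : ξ 0 = ξ₁ := by ext; simp [ξ, hg0]
    have hξa : AnalyticAt ℂ ξ 0 := analyticAt_const.sub (hga.smul analyticAt_const)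
    have hξd : HasDerivAt ξ 0 0 := by
      refine ((hgd.smul_const f).const_sub ξ₁).congr_deriv ?_
      ext
      simp
    refine ⟨χ.symm ∘ τ, ξ, ?_, hξa, ?_, ⟨by rw [hξ0]; exact hξ₁, ?_⟩, ?_, ?_⟩
    · rw [← hτ0] at hsymm
      exact hsymm.comp 0 hτM
    · have hS : ∀ᶠ t in 𝓝 (0 : ℂ), τ t ∈ S :=
        hτa.continuousAt.eventually (h.curve.mem_nhds (by rw [hτ0]; exact hs₁))
      have hne : ∀ᶠ t in 𝓝 (0 : ℂ), ξ t ≠ 0 :=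
        hξa.continuousAt.eventually_ne (by rw [hξ0]; exact hξ₁)
      have hfne : ∀ᶠ t in 𝓝 (0 : ℂ), f (y (τ t)) ≠ 0 :=
        ((f.analyticAt _).comp hya).continuousAt.eventually_ne hfy0
      filter_upwards [hS, hne, hfne] with t ht hξt hft
      refine ⟨hξt, (h.mk_mem_lineFamily_iff hφ ht hξt).2 ?_⟩
      simp [ξ, g, hft]
    · simp only [Function.comp_apply, hτ0, hξ0]
      rfl
    · intro h0
      have hc : χ ∘ (χ.symm ∘ τ) =ᶠ[𝓝 0] τ := by
        have : ∀ᶠ t in 𝓝 (0 : ℂ), τ t ∈ χ.target :=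
          hτa.continuousAt.eventually (χ.open_target.mem_nhds (by rw [hτ0]; exact hs₁t))
        filter_upwards [this] with t ht
        exact χ.right_inv ht
      have hm := hc.mfderiv_eq (I := 𝓘(ℂ)) (I' := 𝓘(ℂ))
      rw [mfderiv_comp (I' := 𝓘(ℂ)) (0 : ℂ)
        (by rw [Function.comp_apply, hτ0]; exact hχ.mdifferentiableAt (by simp))
        (by
          rw [← hτ0] at hsymm
          exact (hsymm.comp 0 hτM).mdifferentiableAt (by simp)), h0, mfderiv_eq_fderiv,
          hτd.hasFDerivAt.fderiv] at hm
      have h3 := congrArg (fun L : ℂ →L[ℂ] ℂ => L 1)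
        ((ContinuousLinearMap.comp_zero _).symm.trans hm)
      simp at h3
    · rw [hξd.deriv]
      exact Submodule.zero_mem _

end Ramification

/-! ### Comparison of two branches through one point. -/

section Branches

open Filter

variable {V : Type*} [NormedAddCommGroup V] [NormedSpace ℂ V]

theorem eventually_not_tangent [CompleteSpace V] {z : ℂ → V} {t : ℂ} (hz : AnalyticAt ℂ z t)
    {ξ₁ : StrongDual ℂ V} (h : ¬ (ξ₁ (z t) = 0 ∧ ξ₁ (deriv z t) = 0)) :
    ∀ᶠ p in 𝓝 (ξ₁, t), ¬ (p.1 (z p.2) = 0 ∧ p.1 (deriv z p.2) = 0) := by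
  have h1 : ContinuousAt (fun p : StrongDual ℂ V × ℂ => p.1 (z p.2)) (ξ₁, t) :=
    continuousAt_fst.clm_apply (ContinuousAt.comp (x := (ξ₁, t)) hz.continuousAt continuousAt_snd)
  have h2 : ContinuousAt (fun p : StrongDual ℂ V × ℂ => p.1 (deriv z p.2)) (ξ₁, t) :=
    continuousAt_fst.clm_apply
      (ContinuousAt.comp (g := deriv z) (f := Prod.snd) (x := (ξ₁, t)) hz.deriv.continuousAt continuousAt_snd)
  by_cases h0 : ξ₁ (z t) = 0
  · filter_upwards [h2.eventually_ne fun h' => h ⟨h0, h'⟩] with p hp hp'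
    exact hp hp'.2
  · filter_upwards [h1.eventually_ne h0] with p hp hp'
    exact hp hp'.1

/-- A branch `z` of the family either contributes nothing to the dual curve near a general point
of the branch `y` close to `ξ₀`, or coincides with it. -/
theorem IsNondegenerateCurve.eventually_branch {y z : ℂ → V} {S R : Set ℂ}
    {T : V →L[ℂ] V →L[ℂ] V →L[ℂ] ℂ} (hT : IsVolumeForm T) (hV : Module.finrank ℂ V = 3)
    (hy : IsNondegenerateCurve y S) (hz : IsNondegenerateCurve z R) {s₀ t₀ : ℂ}
    (hs₀ : s₀ ∈ S) (ht₀ : t₀ ∈ R) (hθ₀ : T (y s₀) (deriv y s₀) ≠ 0)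
    {G : StrongDual ℂ V → ℂ} (hG : AnalyticAt ℂ G (T (y s₀) (deriv y s₀)))
    {N : Set (StrongDual ℂ V)} (hN : N ∈ 𝓝 (T (y s₀) (deriv y s₀))) {B : Set ℂ} (hB : B ∈ 𝓝 s₀)
    (hGN : ∀ ξ ∈ N, G ξ = 0 ↔ ∃ s ∈ B, ξ (y s) = 0 ∧ ξ (deriv y s) = 0)
    (hinj : ∀ ξ ∈ N, ∀ s ∈ B, ∀ t ∈ B, ξ (deriv y s) = 0 → ξ (deriv y t) = 0 → s = t)
    (hor : (T (y s₀) (deriv y s₀)) (z t₀) = 0 → T (z t₀) (deriv z t₀) ≠ 0) :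
    ∃ U ∈ 𝓝 t₀, ∀ᶠ s in 𝓝[≠] s₀, ∀ᶠ ξ in 𝓝 (T (y s) (deriv y s)), ∀ t ∈ U,
      ξ (z t) = 0 → ξ (deriv z t) = 0 → G ξ = 0 := by
  have : FiniteDimensional ℂ V := Module.finite_of_finrank_pos (by omega)
  have : CompleteSpace V := FiniteDimensional.complete ℂ V
  have hθc : Tendsto (fun s => T (y s) (deriv y s)) (𝓝[≠] s₀) (𝓝 (T (y s₀) (deriv y s₀))) :=
    ((hy.analyticAt s₀ hs₀).trilinear_apply_apply
      (hy.analyticAt s₀ hs₀).deriv).continuousAt.tendsto.mono_left nhdsWithin_le_nhds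
  by_cases hram : (T (y s₀) (deriv y s₀)) (z t₀) = 0 ∧ (T (y s₀) (deriv y s₀)) (deriv z t₀) = 0
  swap
  -- Failure of contact is an open condition in `(ξ, t)`, so such a branch stays away.
  · have h := eventually_not_tangent (hz.analyticAt t₀ ht₀) hram
    rw [nhds_prod_eq] at h
    obtain ⟨N', hN', U, hU, hNU⟩ := eventually_prod_iff.1 h
    refine ⟨{t | U t}, hU, ?_⟩
    filter_upwards [hθc.eventually hN'.eventually_nhds] with s hs
    filter_upwards [hs] with ξ hξ t ht h1 h2
    exact absurd ⟨h1, h2⟩ (hNU hξ ht)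
  have hz₀ := hor hram.1
  obtain ⟨κ, hκ⟩ := hT.exists_eq_smul_form hz₀ hram.1 hram.2
  have hκ0 : κ ≠ 0 := by
    rintro rfl
    exact hθ₀ (by rw [hκ]; ext; simp)
  let x : ℂ → StrongDual ℂ V := fun t => κ • T (z t) (deriv z t)
  have hx₀ : x t₀ = T (y s₀) (deriv y s₀) := hκ.symm
  have hza : AnalyticAt ℂ (fun t => T (z t) (deriv z t)) t₀ :=
    (hz.analyticAt t₀ ht₀).trilinear_apply_apply (hz.analyticAt t₀ ht₀).deriv
  have hxa : AnalyticAt ℂ x t₀ :=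
    (analyticAt_const (v := κ)).fun_smul hza
  have hga : AnalyticAt ℂ (fun t => G (x t)) t₀ := by
    rw [← hx₀] at hG
    exact hG.comp hxa
  have hQ : ∀ᶠ t in 𝓝 t₀, T (z t) (deriv z t) ≠ 0 ∧ x t ∈ N ∧ t ∈ R :=
    (hza.continuousAt.eventually_ne hz₀).and
      ((hxa.continuousAt.eventually (by rw [hx₀]; exact hN)).and (hz.mem_nhds ht₀))
  have hprop : ∀ ξ : StrongDual ℂ V, ∀ t, T (z t) (deriv z t) ≠ 0 → ξ (z t) = 0 →
      ξ (deriv z t) = 0 → ∃ ν : ℂ, ξ = ν • x t := by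
    intro ξ t ht h1 h2
    obtain ⟨ν, hν⟩ := hT.exists_eq_smul_form ht h1 h2
    refine ⟨ν / κ, ?_⟩
    rw [hν]
    ext v
    simp only [x, smul_apply, smul_eq_mul]
    field_simp
  rcases hga.eventually_eq_zero_or_eventually_ne_zero with hg | hg
  -- The branches coincide. `G` need not be homogeneous, so `G ξ = 0` passes from `x t` to its
  -- multiple `ξ` through the contact conditions.
  · refine ⟨_, hQ.and hg, ?_⟩
    filter_upwards [hθc.eventually (eventually_mem_nhds_iff.2 hN)] with s hs
    filter_upwards [hs] with ξ hξ t ⟨⟨ht1, ht2, _⟩, ht3⟩ h1 h2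
    obtain ⟨ν, rfl⟩ := hprop ξ t ht1 h1 h2
    obtain ⟨b, hb, h3, h4⟩ := (hGN _ ht2).1 ht3
    exact (hGN _ hξ).2 ⟨b, hb, by simp [h3], by simp [h4]⟩
  -- The branches meet only at `t₀` within `U`: for `t ≠ t₀` since `G (x t) ≠ 0`, and for `t = t₀`
  -- since the contact parameter in `B` is unique and `s ≠ s₀`. Compactness of `U` makes the
  -- neighbourhood of `T(y, y')` uniform in `t`.
  · rw [eventually_nhdsWithin_iff] at hg
    obtain ⟨U, hU, hUQ, hUc⟩ := local_compact_nhds (hQ.and hg)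
    refine ⟨U, hU, ?_⟩
    filter_upwards [hθc.eventually hN, nhdsWithin_le_nhds hB, self_mem_nhdsWithin,
      hθc.eventually_ne hθ₀] with s hsN hsB hss₀ hs0
    have key : ∀ t ∈ U, ∀ᶠ p : StrongDual ℂ V × ℂ in 𝓝 (T (y s) (deriv y s), t),
        ¬ (p.1 (z p.2) = 0 ∧ p.1 (deriv z p.2) = 0) := by
      intro t ht
      obtain ⟨⟨ht1, ht2, ht3⟩, ht4⟩ := hUQ ht
      refine eventually_not_tangent (hz.analyticAt t ht3) ?_
      rintro ⟨h1, h2⟩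
      obtain ⟨ν, hν⟩ := hprop _ t ht1 h1 h2
      have hν0 : ν ≠ 0 := by
        rintro rfl
        exact hs0 (by rw [hν]; ext; simp)
      have h3 : x t (y s) = 0 := by
        have := hT.self_outer (y s) (deriv y s)
        rw [hν] at this
        simpa [hν0] using this
      have h4 : x t (deriv y s) = 0 := by
        have := hT.self_right (y s) (deriv y s)
        rw [hν] at this
        simpa [hν0] using this
      have htt : t = t₀ := by
        by_contra hne
        exact ht4 hne ((hGN _ ht2).2 ⟨s, hsB, h3, h4⟩)
      rw [htt, hx₀] at h4
      exact hss₀ (hinj _ (mem_of_mem_nhds hN) s hsB s₀ (mem_of_mem_nhds hB) h4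
        (hT.self_right _ _))
    have h := hUc.eventually_forall_of_forall_eventually (P := fun (ξ : StrongDual ℂ V) t =>
      ¬ (ξ (z t) = 0 ∧ ξ (deriv z t) = 0)) key
    filter_upwards [h] with ξ hξ t ht h1 h2
    exact absurd ⟨h1, h2⟩ (hξ t ht)

end Branches

/-! ### Open sets, closed sets and limits in projective space. -/

section ProjectiveTopology

open Filter

variable {V : Type*} [NormedAddCommGroup V] [NormedSpace ℂ V]

theorem isOpen_setOf_exists_mk_mem {O : Set (ℙ ℂ V)} (hO : IsOpen O) :
    IsOpen {v : V | ∃ h : v ≠ 0, Projectivization.mk ℂ v h ∈ O} := by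
  have hc : Continuous (Projectivization.mk' ℂ : {v : V // v ≠ 0} → ℙ ℂ V) :=
    continuous_quotient_mk'
  have h : {v : V | ∃ h : v ≠ 0, Projectivization.mk ℂ v h ∈ O} =
      Subtype.val '' (Projectivization.mk' ℂ ⁻¹' O) := by
    ext v
    constructor
    · rintro ⟨h, hv⟩
      exact ⟨⟨v, h⟩, hv, rfl⟩
    · rintro ⟨w, hw, rfl⟩
      exact ⟨w.2, hw⟩
  rw [h]
  exact isOpen_ne.isOpenMap_subtype_val _ (hO.preimage hc)

theorem isClosed_of_mk_mem_iff {A : Set (ℙ ℂ V)} {K : Set V} (hK : IsClosed K)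
    (h : ∀ (v : V) (hv : v ≠ 0), Projectivization.mk ℂ v hv ∈ A ↔ v ∈ K) : IsClosed A := by
  have hq : Topology.IsQuotientMap (Projectivization.mk' ℂ : {v : V // v ≠ 0} → ℙ ℂ V) :=
    isQuotientMap_quotient_mk'
  rw [← hq.isClosed_preimage]
  have : Projectivization.mk' ℂ ⁻¹' A = (Subtype.val : {v : V // v ≠ 0} → V) ⁻¹' K := by
    ext v
    exact h v.1 v.2
  rw [this]
  exact hK.preimage continuous_subtype_val

theorem mk_mem_closure_of_frequently {A : Set (ℙ ℂ V)} {y : ℂ → V} {s₀ : ℂ}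
    (hy : ContinuousAt y s₀) (h0 : y s₀ ≠ 0)
    (h : ∃ᶠ s in 𝓝 s₀, ∀ hs : y s ≠ 0, Projectivization.mk ℂ (y s) hs ∈ A) :
    Projectivization.mk ℂ (y s₀) h0 ∈ closure A := by
  rw [mem_closure_iff]
  intro O hO hmem
  obtain ⟨s, h1, h2, h3⟩ := (h.and_eventually (hy.eventually
    ((isOpen_setOf_exists_mk_mem hO).mem_nhds ⟨h0, hmem⟩))).exists
  exact ⟨_, h3, h1 h2⟩

end ProjectiveTopology

/-! ### The global duality statement, by compactness of `C`. -/

section Duality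

open Filter

variable {V : Type*} [NormedAddCommGroup V] [NormedSpace ℂ V]
  {C : Type*} [TopologicalSpace C] [ChartedSpace ℂ C]
  {F : C → Type*} [∀ c, AddCommGroup (F c)] [∀ c, Module ℂ (F c)]
  {φ : ∀ c, V →ₗ[ℂ] F c} {T : V →L[ℂ] V →L[ℂ] V →L[ℂ] ℂ}

theorem mem_envelope_iff {p : ℙ ℂ (StrongDual ℂ V)} :
    p ∈ envelope φ ↔ ∃ c, (c, p) ∈ ramificationLocus φ := by
  simp [envelope]

/-- Near `c` the incidence `φ c v = 0` reads `T(y, v) = 0`, a closed condition in `(v, c)`; its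
projection along the compact `C` is closed. -/
theorem isClosed_wedgeCurve [CompactSpace C] (hT : IsVolumeForm T) (hV : Module.finrank ℂ V = 3)
    (hF : ∀ c, Module.finrank ℂ (F c) = 2) (hφ : ∀ c, Function.Surjective (φ c))
    (hlift : ∀ c₀ : C, ∃ y S, IsLocalLift φ c₀ y S) : IsClosed (wedgeCurve φ) := by
  refine isClosed_of_mk_mem_iff (K := {v | ∃ c, φ c v = 0}) ?_
    fun v hv => mk_mem_wedgeCurve_iff hV hF hφ hv
  rw [← isOpen_compl_iff, isOpen_iff_mem_nhds]
  intro v₀ hv₀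
  have h : ∀ᶠ v in 𝓝 v₀, ∀ c ∈ (Set.univ : Set C), φ c v ≠ 0 := by
    refine isCompact_univ.eventually_forall_of_forall_eventually fun c _ => ?_
    obtain ⟨y, S, h⟩ := hlift c
    have hne : T (y (chartAt ℂ c c)) v₀ ≠ 0 := by
      intro h0
      apply hv₀
      refine ⟨c, ?_⟩
      have h1 := (h.apply_eq_zero_iff _ h.mem v₀).2
        (hT.exists_eq_smul_of_eq_zero hV (h.curve.ne_zero _ h.mem) h0)
      rwa [(chartAt ℂ c).left_inv (mem_chart_source ℂ c)] at h1
    have hχ : ContinuousAt (chartAt ℂ c) c :=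
      (chartAt ℂ c).continuousAt (mem_chart_source ℂ c)
    have hyc : ContinuousAt (fun p : V × C => y (chartAt ℂ c p.2)) (v₀, c) :=
      ((h.curve.analyticAt _ h.mem).continuousAt.comp hχ).comp
        (x := (v₀, c)) (f := Prod.snd) continuousAt_snd
    have hc : ContinuousAt (fun p : V × C => T (y (chartAt ℂ c p.2)) p.1) (v₀, c) :=
      (ContinuousAt.comp (g := T) (f := fun p : V × C => y (chartAt ℂ c p.2))
        T.continuous.continuousAt hyc).clm_apply continuousAt_fst
    have hS : ∀ᶠ p : V × C in 𝓝 (v₀, c), chartAt ℂ c p.2 ∈ S :=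
      (hχ.comp (x := (v₀, c)) (f := Prod.snd) continuousAt_snd).eventually
        (h.curve.mem_nhds h.mem)
    have hs : ∀ᶠ p : V × C in 𝓝 (v₀, c), p.2 ∈ (chartAt ℂ c).source :=
      continuousAt_snd.eventually
        ((chartAt ℂ c).open_source.mem_nhds (mem_chart_source ℂ c))
    filter_upwards [hc.eventually_ne hne, hS, hs] with p h1 h2 h3 h4
    rw [← (chartAt ℂ c).left_inv h3] at h4
    obtain ⟨μ, hμ⟩ := (h.apply_eq_zero_iff _ h2 _).1 h4
    apply h1
    rw [hμ, map_smul]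
    ext
    simp [hT.self_left]
  filter_upwards [h] with v hv hv'
  obtain ⟨c, hc⟩ := hv'
  exact hv c trivial hc

/-- One branch through the point suffices: the equation of the envelope vanishes on it, and this
already determines the tangent. -/
theorem tangentLine_mem_wedgeCurve [IsManifold 𝓘(ℂ) ω C] (hT : IsVolumeForm T)
    (hV : Module.finrank ℂ V = 3)
    (hF : ∀ c, Module.finrank ℂ (F c) = 2) (hφ : ∀ c, Function.Surjective (φ c))
    (hlift : ∀ c₀ : C, ∃ y S, IsLocalLift φ c₀ y S) {p : ℙ ℂ (StrongDual ℂ V)} {q : ℙ ℂ V}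
    (h : IsTangentLineAt (envelope φ) p q) : q ∈ wedgeCurve φ := by
  obtain ⟨hp, ξ₀, hξ₀, v, hv, G, rfl, rfl, hG, hev, hfd⟩ := h
  obtain ⟨c, hc⟩ := mem_envelope_iff.1 hp
  obtain ⟨y, S, h⟩ := hlift c
  have hcc := (chartAt ℂ c).left_inv (mem_chart_source ℂ c)
  rw [← hcc, h.mk_mem_ramificationLocus_iff hφ h.mem hξ₀] at hc
  have hD : ∀ᶠ ξ in 𝓝 ξ₀, ∀ s ∈ S, ξ (y s) = 0 → ξ (deriv y s) = 0 → G ξ = 0 := by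
    filter_upwards [hev, continuousAt_id.eventually_ne hξ₀] with ξ h1 h2 s hs h3 h4
    exact (h1 h2).1 (mem_envelope_iff.2
      ⟨_, (h.mk_mem_ramificationLocus_iff hφ hs h2).2 ⟨h3, h4⟩⟩)
  have hvy := h.curve.tangent_eq_smul hT hV h.mem hξ₀ hc.1 hc.2 hG hD hfd
  rw [mk_mem_wedgeCurve_iff hV hF hφ hv]
  exact ⟨_, (h.apply_eq_zero_iff _ h.mem v).2 hvy⟩

/-- The points of `C` over which the whole line of the family is ramified. -/
def ramifiedFibres (φ : ∀ c, V →ₗ[ℂ] F c) : Set C :=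
  {c | ∀ p, (c, p) ∈ lineFamily φ → (c, p) ∈ ramificationLocus φ}

theorem IsLocalLift.mem_ramifiedFibres_iff [IsManifold 𝓘(ℂ) ω C] {c₀ : C} {y : ℂ → V} {S : Set ℂ}
    (h : IsLocalLift φ c₀ y S) (hT : IsVolumeForm T) (hV : Module.finrank ℂ V = 3)
    (hφ : ∀ c, Function.Surjective (φ c)) {s : ℂ} (hs : s ∈ S) :
    (chartAt ℂ c₀).symm s ∈ ramifiedFibres φ ↔ T (y s) (deriv y s) = 0 := by
  constructor
  · intro hc
    obtain ⟨μ, hμ⟩ := mem_span_singleton_of_forall_dual (a := y s) (b := deriv y s) fun ξ hξ => by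
      by_cases h0 : ξ = 0
      · simp [h0]
      · exact ((h.mk_mem_ramificationLocus_iff hφ hs h0).1
          (hc _ ((h.mk_mem_lineFamily_iff hφ hs h0).2 hξ))).2
    rw [hμ]
    ext
    simp [hT.self_left]
  · intro h0 p hp
    obtain ⟨μ, hμ⟩ := hT.exists_eq_smul_of_eq_zero hV (h.curve.ne_zero s hs) h0
    rw [← p.mk_rep] at hp ⊢
    have h1 := (h.mk_mem_lineFamily_iff hφ hs p.rep_nonzero).1 hp
    exact (h.mk_mem_ramificationLocus_iff hφ hs p.rep_nonzero).2
      ⟨h1, by rw [hμ, map_smul, h1, smul_zero]⟩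

/-- These points are the zeros of `y ∧ y'`, which are isolated, and `C` is compact. -/
theorem finite_ramifiedFibres [IsManifold 𝓘(ℂ) ω C] [CompactSpace C] (hT : IsVolumeForm T)
    (hV : Module.finrank ℂ V = 3) (hφ : ∀ c, Function.Surjective (φ c))
    (hlift : ∀ c₀ : C, ∃ y S, IsLocalLift φ c₀ y S) : (ramifiedFibres φ).Finite := by
  by_contra hinf
  obtain ⟨c, hc⟩ := Set.Infinite.exists_accPt_principal hinf
  obtain ⟨y, S, h⟩ := hlift c
  rw [accPt_iff_frequently_nhdsNE] at hc
  refine hc ?_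
  have hsrc := (chartAt ℂ c).open_source.mem_nhds (mem_chart_source ℂ c)
  have hχ : ContinuousAt (chartAt ℂ c) c :=
    (chartAt ℂ c).continuousAt (mem_chart_source ℂ c)
  have hev : ∀ᶠ s in 𝓝 (chartAt ℂ c c), s ≠ chartAt ℂ c c → T (y s) (deriv y s) ≠ 0 := by
    refine eventually_nhdsWithin_iff (s := {chartAt ℂ c c}ᶜ).1 ?_
    filter_upwards [h.curve.eventually_wedge_ne_zero hT hV h.mem (h.curve.ne_zero _ h.mem)]
      with s hs h0
    exact hs (by rw [h0]; rfl)
  filter_upwards [nhdsWithin_le_nhds hsrc, nhdsWithin_le_nhds (hχ.eventually hev),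
    nhdsWithin_le_nhds (hχ.eventually (h.curve.mem_nhds h.mem)), self_mem_nhdsWithin]
    with d h1 h2 h3 h4 h5
  rw [← (chartAt ℂ c).left_inv h1, h.mem_ramifiedFibres_iff hT hV hφ h3] at h5
  exact h2 (fun h6 => h4 ((chartAt ℂ c).injOn h1 (mem_chart_source ℂ c) h6)) h5

/-- `hram` keeps the point `[T(y, y')]` off the lines contained in the envelope, as the comparison
of branches requires. The value `s₀` itself is excluded because distinct branches may cross there.
-/
theorem IsLocalLift.eventually_isTangentLineAt [IsManifold 𝓘(ℂ) ω C] [CompactSpace C]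
    (hT : IsVolumeForm T) (hV : Module.finrank ℂ V = 3) (hφ : ∀ c, Function.Surjective (φ c))
    (hlift : ∀ c₀ : C, ∃ y S, IsLocalLift φ c₀ y S) {c₀ : C} {y : ℂ → V} {S : Set ℂ}
    (h : IsLocalLift φ c₀ y S) {s₀ : ℂ} (hs₀ : s₀ ∈ S)
    (hosc : T (y s₀) (deriv y s₀) (deriv (deriv y) s₀) ≠ 0)
    (hram : ∀ c ∈ ramifiedFibres φ, ∀ w, w ≠ 0 → φ c w = 0 → T (y s₀) (deriv y s₀) w ≠ 0) :
    ∀ᶠ s in 𝓝[≠] s₀, ∀ hs : y s ≠ 0,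
      ∃ p, IsTangentLineAt (envelope φ) p (Projectivization.mk ℂ (y s) hs) := by
  have : FiniteDimensional ℂ V := Module.finite_of_finrank_pos (by omega)
  have : CompleteSpace V := FiniteDimensional.complete ℂ V
  have hθ₀ : T (y s₀) (deriv y s₀) ≠ 0 := fun h0 => hosc (by rw [h0]; rfl)
  obtain ⟨G, N, hN, B, hB, hBS, hGN, hinj, hGd⟩ := exists_dual_equation
    (h.curve.analyticAt s₀ hs₀) (hT.self_right _ _) hosc (h.curve.mem_nhds hs₀)
  have hG₀ := (hGd _ (mem_of_mem_nhds hN) s₀ (mem_of_mem_nhds hB) (hT.self_right _ _)).1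
  have hθc : Tendsto (fun s => T (y s) (deriv y s)) (𝓝[≠] s₀) (𝓝 (T (y s₀) (deriv y s₀))) :=
    ((h.curve.analyticAt s₀ hs₀).trilinear_apply_apply
      (h.curve.analyticAt s₀ hs₀).deriv).continuousAt.tendsto.mono_left nhdsWithin_le_nhds
  have hall : ∀ᶠ s in 𝓝[≠] s₀, ∀ᶠ ξ in 𝓝 (T (y s) (deriv y s)), ∀ c ∈ (Set.univ : Set C),
      ∀ hξ : ξ ≠ 0, (c, Projectivization.mk ℂ ξ hξ) ∈ ramificationLocus φ → G ξ = 0 := by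
    -- The property of a set of parameters is stable under subsets and finite unions, so a
    -- neighbourhood of each `c` is enough.
    refine isCompact_univ.induction_on
      (p := fun K : Set C => ∀ᶠ s in 𝓝[≠] s₀, ∀ᶠ ξ in 𝓝 (T (y s) (deriv y s)), ∀ c ∈ K,
        ∀ hξ : ξ ≠ 0, (c, Projectivization.mk ℂ ξ hξ) ∈ ramificationLocus φ → G ξ = 0)
      (by simp) ?_ ?_ ?_
    · intro K K' hK h'
      filter_upwards [h'] with s hs
      filter_upwards [hs] with ξ hξ c hc
      exact hξ c (hK hc)
    · intro K K' h1 h2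
      filter_upwards [h1, h2] with s hs1 hs2
      filter_upwards [hs1, hs2] with ξ hξ1 hξ2 c hc
      exact hc.elim (hξ1 c) (hξ2 c)
    · intro c _
      obtain ⟨z, R, hz⟩ := hlift c
      have hcc := (chartAt ℂ c).left_inv (mem_chart_source ℂ c)
      obtain ⟨U, hU, hUe⟩ := h.curve.eventually_branch hT hV hz.curve hs₀ hz.mem hθ₀ hG₀ hN hB
        hGN hinj (by
          intro h0 h1
          rw [← hz.mem_ramifiedFibres_iff hT hV hφ hz.mem] at h1
          exact hram _ h1 _ (hz.curve.ne_zero _ hz.mem)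
            ((hz.apply_eq_zero_iff _ hz.mem _).2 ⟨1, (one_smul _ _).symm⟩) h0)
      have hχ : ContinuousAt (chartAt ℂ c) c :=
        (chartAt ℂ c).continuousAt (mem_chart_source ℂ c)
      refine ⟨_, nhdsWithin_le_nhds (inter_mem
        (inter_mem (hχ.eventually hU) (hχ.eventually (hz.curve.mem_nhds hz.mem)))
        ((chartAt ℂ c).open_source.mem_nhds (mem_chart_source ℂ c))), ?_⟩
      filter_upwards [hUe] with s hs
      filter_upwards [hs] with ξ hξ d ⟨⟨hd1, hd2⟩, hd3⟩ hξ0 hmem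
      rw [← (chartAt ℂ c).left_inv hd3,
        hz.mk_mem_ramificationLocus_iff hφ hd2 hξ0] at hmem
      exact hξ _ hd1 hmem.1 hmem.2
  filter_upwards [hall, hθc.eventually (eventually_mem_nhds_iff.2 hN),
    nhdsWithin_le_nhds hB, hθc.eventually_ne hθ₀] with s h1 h2 hsB h4 hys
  have hd := hGd _ (mem_of_mem_nhds h2) s hsB (hT.self_right _ _)
  refine ⟨Projectivization.mk ℂ _ h4, mem_envelope_iff.2 ⟨_,
    (h.mk_mem_ramificationLocus_iff hφ (hBS hsB) h4).2 ⟨hT.self_outer _ _, hT.self_right _ _⟩⟩,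
    _, h4, y s, hys, G, rfl, rfl, hd.1, ?_, hd.2⟩
  filter_upwards [h1, h2] with ξ hξ1 hξ2 hξ0
  rw [mem_envelope_iff]
  constructor
  · rintro ⟨c, hc⟩
    exact hξ1 c trivial hξ0 hc
  · intro hG
    obtain ⟨t, htB, ht⟩ := (hGN ξ hξ2).1 hG
    exact ⟨_, (h.mk_mem_ramificationLocus_iff hφ (hBS htB) hξ0).2 ht⟩

/-- Two limits are taken: tangent lines near a general `s` put `[y s]` in the closure, and general
`s` then tend to the given point. -/
theorem IsLocalLift.mk_mem_dualCurve [IsManifold 𝓘(ℂ) ω C] [CompactSpace C]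
    (hT : IsVolumeForm T) (hV : Module.finrank ℂ V = 3)
    (hF : ∀ c, Module.finrank ℂ (F c) = 2) (hφ : ∀ c, Function.Surjective (φ c))
    (hlift : ∀ c₀ : C, ∃ y S, IsLocalLift φ c₀ y S) {c₀ : C} {y : ℂ → V} {S : Set ℂ}
    (h : IsLocalLift φ c₀ y S) :
    Projectivization.mk ℂ (y (chartAt ℂ c₀ c₀)) (h.curve.ne_zero _ h.mem) ∈
      dualCurve (envelope φ) := by
  have hram : ∀ᶠ s in 𝓝[≠] (chartAt ℂ c₀ c₀), ∀ c ∈ ramifiedFibres φ, ∀ w, w ≠ 0 →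
      φ c w = 0 → T (y s) (deriv y s) w ≠ 0 := by
    -- For each of the finitely many whole lines, with kernel vector `k`, the function `T(y, y') k`
    -- has isolated zeros.
    refine (eventually_all_finite (finite_ramifiedFibres hT hV hφ hlift)).2 fun c _ => ?_
    obtain ⟨k, hk0, hk⟩ := exists_ne_zero_apply_eq_zero hV (hF c) (hφ c)
    filter_upwards [h.curve.eventually_wedge_ne_zero hT hV h.mem hk0] with s hs w hw0 hw hTw
    obtain ⟨μ, hμ⟩ := exists_eq_smul_of_apply_eq_zero hV (hF c) (hφ c) hw0 hw hk
    exact hs (by rw [hμ, map_smul, hTw, smul_zero])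
  have hcl : ∀ᶠ s in 𝓝[≠] (chartAt ℂ c₀ c₀), ∀ hs : y s ≠ 0,
      Projectivization.mk ℂ (y s) hs ∈ dualCurve (envelope φ) := by
    filter_upwards [hram, h.curve.eventually_osculating_ne_zero hT hV h.mem,
      nhdsWithin_le_nhds (h.curve.mem_nhds h.mem)] with s h1 h2 h3 hs
    exact mk_mem_closure_of_frequently (h.curve.analyticAt s h3).continuousAt hs
      ((h.eventually_isTangentLineAt hT hV hφ hlift h3 h2 h1).frequently.filter_mono
        nhdsWithin_le_nhds)
  have hmem := mk_mem_closure_of_frequently (h.curve.analyticAt _ h.mem).continuousAt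
    (h.curve.ne_zero _ h.mem) (hcl.frequently.filter_mono nhdsWithin_le_nhds)
  rwa [dualCurve, closure_closure] at hmem

theorem dualCurve_envelope [IsManifold 𝓘(ℂ) ω C] [CompactSpace C]
    (hV : Module.finrank ℂ V = 3) (hF : ∀ c, Module.finrank ℂ (F c) = 2)
    (hφ : ∀ c, Function.Surjective (φ c)) (hlift : ∀ c₀ : C, ∃ y S, IsLocalLift φ c₀ y S) :
    dualCurve (envelope φ) = wedgeCurve φ := by
  obtain ⟨T, hT⟩ := exists_isVolumeForm hV
  refine Set.Subset.antisymm (closure_minimal ?_ (isClosed_wedgeCurve hT hV hF hφ hlift)) ?_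
  · rintro q ⟨p, hp⟩
    exact tangentLine_mem_wedgeCurve hT hV hF hφ hlift hp
  · intro q hq
    obtain ⟨c, hc⟩ := (mem_wedgeCurve_iff hV hF hφ).1 hq
    obtain ⟨y, S, h⟩ := hlift c
    rw [← (chartAt ℂ c).left_inv (mem_chart_source ℂ c), h.apply_eq_zero_iff _ h.mem] at hc
    obtain ⟨μ, hμ⟩ := hc
    have hq' : q = Projectivization.mk ℂ _ (h.curve.ne_zero _ h.mem) := by
      rw [← q.mk_rep, Projectivization.mk_eq_mk_iff']
      exact ⟨μ, hμ.symm⟩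
    rw [hq']
    exact h.mk_mem_dualCurve hT hV hF hφ hlift

end Duality

/-- Let `C` be a smooth projective complex curve (a compact connected Riemann surface) and
`φ : V_C → F` a surjection of vector bundles from the trivial bundle with fibre `V ≅ ℂ³` onto a
bundle of rank 2 (its kernel is then a line bundle), such that `ψ : P(F) → P(V)` is finite.
The dual curve of the envelope of `P(F)` is the image of `C` under the map given by `⋀² φ`. -/
theorem mainTheorem13
    {V : Type*} [NormedAddCommGroup V] [NormedSpace ℂ V] (hV : Module.finrank ℂ V = 3)
    {C : Type*} [TopologicalSpace C] [T2Space C] [CompactSpace C] [ConnectedSpace C]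
    [ChartedSpace ℂ C] [IsManifold 𝓘(ℂ) ω C]
    {E : Type*} [NormedAddCommGroup E] [NormedSpace ℂ E] (hE : Module.finrank ℂ E = 2)
    {F : C → Type*} [TopologicalSpace (Bundle.TotalSpace E F)] [∀ c, AddCommGroup (F c)]
    [∀ c, Module ℂ (F c)] [∀ c, TopologicalSpace (F c)] [FiberBundle E F] [VectorBundle ℂ E F]
    [ContMDiffVectorBundle ω E F 𝓘(ℂ)]
    (φ : ∀ c, V →ₗ[ℂ] F c)
    (hφ_hol : ∀ a : V, ContMDiff 𝓘(ℂ) (𝓘(ℂ).prod 𝓘(ℂ, E)) ω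
      (fun c => (Bundle.TotalSpace.mk' E c (φ c a) : Bundle.TotalSpace E F)))
    (hφ_surj : ∀ c, Function.Surjective (φ c))
    (hψ : FiniteProjection φ) :
    dualCurve (envelope φ) = wedgeCurve φ := by
  have hF : ∀ c, Module.finrank ℂ (F c) = 2 := fun c => by
    rw [← hE]
    exact ((trivializationAt E F c).linearEquivAt ℂ c
      (FiberBundle.mem_baseSet_trivializationAt' c)).finrank_eq
  exact dualCurve_envelope hV hF hφ_surj (exists_isLocalLift hV hE hφ_hol hφ_surj hψ)
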